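/- **Setting.** All registers consist of qubits, bitstrings are added modulo 2, $\Pi_t=|t\rangle\langle t|$ denotes a computational-basis projector, a Pauli channel is a map $\rho\mapsto\sum_P\mu_P\,P\rho P$ with $\mu$ a probability distribution on the Pauli operators $\{I,X,Y,Z\}^{\otimes n}$, and $f(P)$ denotes the bitstring with $P\Pi_tP=\Pi_{t+f(P)}$. We describe a stabilizer code in its Clifford frame by a logical register $L$ of $k$ qubits ($D=2^k$) and a syndrome register $S$, whose bitstrings are the syndromes; $s_*$ is the default syndrome. *QEC cycle.* A noisy QEC cycle uses an ancilla register $A$ and an outcome register $O$. A Clifford unitary $C$ on $S,A,O$ acts as $C(\Pi_t\otimes\Pi_a\otimes\Pi_0)C^\dagger=\Pi_t\otimes\Pi_{b(t)}\otimes\Pi_{E(t)}$ for all syndromes $t$; then a Pauli channel with probabilities $\mu_P$, $P=P_\ell\otimes P_s\otimes P_a\otimes P_o$, acts on $L,S,A,O$; then $O$ is read in the computational basis, giving $\theta$, and with $s_{\rm err}=\mathcal D(\theta)+s_*$ ($\mathcal D$ any decoding function) one applies $X^{s_{\rm err}}$ to $S$ and the Pauli correction $\mathcal C_{s_{\rm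 err}}$ to $L$ ($\mathcal C_0=\mathrm{id}$); finally $A$ and $O$ are discarded. The cycle may be modified by syndrome-state randomization: before $C$, a uniformly random $X^{r}$ is applied to $S$, and the logical correction is $\mathcal C_{s_{\rm err}+r}$ while the reset is unchanged (otherwise $r=0$). On $\rho_L\otimes\Pi_{s_{\rm in}}$ the cycle acts as $$\rho_L\otimes\Pi_{s_{\rm in}}\mapsto\sum_{s_{\rm out}}\gamma_{s_{\rm out},s_{\rm in}}\,\Lambda_{s_{\rm out},s_{\rm in}}(\rho_L)\otimes\Pi_{s_{\rm out}},$$ where $\gamma_{s_{\rm out},s_{\rm in}}$ is the probability, over $r$ and $P$, that $s_{\rm in}+r+f(P_s)+s_{\rm err}=s_{\rm out}$ with $s_{\rm err}=\mathcal D(E(s_{\rm in}+r)+f(P_o))+s_*$, and $\Lambda_{s_{\rm out},s_{\rm in}}$ is the corresponding conditional average of $\mathcal C_{s_{\rm err}+r}\circ(P_\ell\cdot P_\ell)$ (zero if $\gamma_{s_{\rm out},s_{\rm in}}=0$). The cycle has the *syndrome marginal independence property* if $\gamma_{s_{\rm out},s_{\rm in}}=:\gamma_{s_{\rm out}}$ does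 not depend on $s_{\rm in}$. In that case let $$\Lambda_1=\sum_{s_{\rm out},s_{\rm in}}\gamma_{s_{\rm out}}\gamma_{s_{\rm in}}\;\mathcal C_{s_{\rm out}+s_*}\circ\Lambda_{s_{\rm out},s_{\rm in}}\circ\mathcal C_{s_{\rm in}+s_*}^\dagger ,\qquad f_1=\frac1{D^3}\sum_{P}\operatorname{tr}\big(P\,\Lambda_1(P)\big),$$ the sum running over the Pauli operators $P$ of $L$; $f_1$ is the *single-cycle logical entanglement fidelity*. *Preparations.* A preparation $p$ consists of a logical density matrix $\sigma_L$ and a Pauli channel applied to $\sigma_L\otimes\Pi_{s_*}$. The result is $\sum_t\gamma^{\rm prep}_t\Lambda^{\rm prep}_t(\sigma_L)\otimes\Pi_t$, with $\gamma^{\rm prep}$ the distribution of the syndrome and $\Lambda^{\rm prep}_t$ the conditional logical Pauli channel. *Measurements.* A measurement $m$ consists of a logical Clifford unitary $V$, with target POVM $M_x=V^\dagger\Pi_xV$; a Clifford unitary $C_{\rm meas}$ on $L,S$ and fresh registers $A,O$ with $C_{\rm meas}(V^\dagger|x\rangle\otimes|t\rangle\otimes|a\rangle\otimes|0\rangle)=|x\rangle\otimes|t\rangle\otimes|b(x,t)\rangle\otimes|E_m(x,t)\rangle$;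 a Pauli channel on $L,S,A,O$ after it; and a function $\mathcal D_m$ that turns the content of $O$ into the outcome. $\Lambda^{\rm meas}_t$ is the logical channel $\rho\mapsto\sum_{x,y}q_t(x|y)\operatorname{tr}(M_y\rho)\,M_x$, where $q_t(x|y)$ is the probability that $\mathcal D_m(E_m(y,t)+f(P_o))=x$; thus $\operatorname{tr}(M_x\Lambda^{\rm meas}_t(\rho))$ is the probability of the outcome $x$ on $\rho\otimes\Pi_t$. *Experiments and models.* A set of experimental settings is a set $\mathsf{Exp}$ of pairs $(p,m)$. The experiment with setting $(p,m)$ and $K\ge1$ cycles performs $p$, then $K$ times the cycle, then $m$. Its total logical error channel is $$\Lambda^{(K)}_{p,m}=\sum_{s_0,\dots,s_K}\gamma_{s_K,s_{K-1}}\cdots\gamma_{s_1,s_0}\gamma^{\rm prep}_{s_0}\;\Lambda^{\rm meas}_{s_K}\circ\Lambda_{s_K,s_{K-1}}\circ\cdots\circ\Lambda_{s_1,s_0}\circ\Lambda^{\rm prep}_{s_0}.$$ A logical Markovian model consists of linear superoperators $\Phi_{{\rm prep},p}$, $\Phi_{\rm QEC}$, $\Phi_{{\rm meas},m}$ on the operators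 of $L$, with $\Phi_{\rm QEC}$ independent of the setting. For $G>0$ and $0<\epsilon<1$ it is a *$(G,\epsilon)$-approximate* logical Markovian model for $\mathsf{Exp}$ if for all $(p,m)\in\mathsf{Exp}$, all $K\ge1$ and all outcomes $x$, $$\Big|\operatorname{tr}\big(M_x\,\Lambda^{(K)}_{p,m}(\sigma_L)\big)-\operatorname{tr}\big(M_x\,\Phi_{{\rm meas},m}\Phi_{\rm QEC}^K\Phi_{{\rm prep},p}(\sigma_L)\big)\Big|\le G\,\epsilon^K .$$ **Theorem.** Consider a fixed noisy QEC cycle as above that has the syndrome marginal independence property, and suppose $f_1\ge1-\epsilon_1$ with $0<\epsilon_1\le1/64$. Let $\mathsf{Exp}$ be a set of experimental settings such that $\gamma^{\rm prep}=\gamma$ (the syndrome marginal distribution of the cycle) for every preparation that occurs in $\mathsf{Exp}$. Put $$\epsilon=2(1+\sqrt2)\sqrt{\epsilon_1},\qquad G'=1+\frac1{1-\epsilon/(1-2\sqrt{\epsilon_1})},\qquad G=G'\sqrt D .$$ Then $G'<7$, and there is a $(G,\epsilon)$-approximate logical Markovian model for $\mathsf{Exp}$. Moreover, for every setting $(p,m)\in\mathsf{Exp}$,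 every $K\ge1$ and every $x$, the probability of the outcome $x$ in the experiment with $K$ cycles deviates from the model's prediction $\operatorname{tr}(M_x\Phi_{{\rm meas},m}\Phi_{\rm QEC}^K\Phi_{{\rm prep},p}(\sigma_L))$ by at most $G\epsilon^K$. -/

import Mathlib

open scoped Matrix Kronecker ComplexOrder

namespace QEC

/-! ### Bitstrings, Pauli operators, superoperators -/

/-- Bitstrings of an `n`-qubit register; addition is bitwise XOR.
They label the computational basis. -/
abbrev Bits (n : ℕ) : Type := Fin n → ZMod 2

/-- Labels of the single-qubit Pauli operators. -/
inductive Pauli1 : Type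
  | I | X | Y | Z
  deriving DecidableEq

instance : Fintype Pauli1 where
  elems := {.I, .X, .Y, .Z}
  complete := by rintro (_ | _ | _ | _) <;> decide

/-- The `2 × 2` Pauli matrices, with rows and columns labelled by a bit. -/
noncomputable def Pauli1.mat : Pauli1 → Matrix (ZMod 2) (ZMod 2) ℂ
  | .I => 1
  | .X => Matrix.of fun a b => if a = b + 1 then 1 else 0
  | .Y => Matrix.of fun a b =>
      if a = b + 1 then (if b = 0 then Complex.I else -Complex.I) else 0
  | .Z => Matrix.of fun a b => if a = b then (if a = 0 then 1 else -1) else 0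

/-- Whether a single-qubit Pauli operator flips a computational-basis state. -/
def Pauli1.flip : Pauli1 → ZMod 2
  | .I => 0
  | .X => 1
  | .Y => 1
  | .Z => 0

/-- Labels of the `4 ^ n` Pauli operators on `n` qubits. -/
abbrev Pauli (n : ℕ) : Type := Fin n → Pauli1

/-- The Pauli operator `Q₁ ⊗ ⋯ ⊗ Qₙ` as a matrix in the computational basis. -/
noncomputable def Pauli.mat {n : ℕ} (P : Pauli n) : Matrix (Bits n) (Bits n) ℂ :=
  Matrix.of fun x y => ∏ j, (P j).mat (x j) (y j)

/-- The unique bitstring `t` with `P |s⟩⟨s| P = |s + t⟩⟨s + t|` for all `s`. -/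
def Pauli.flip {n : ℕ} (P : Pauli n) : Bits n := fun j => (P j).flip

/-- The bit-flip operator `X ^ t`. -/
def xPauli {n : ℕ} (t : Bits n) : Pauli n := fun j => if t j = 0 then Pauli1.I else Pauli1.X

/-- The projector `|s⟩⟨s|` onto a computational-basis state. -/
def proj {ι : Type*} [DecidableEq ι] (s : ι) : Matrix ι ι ℂ := Matrix.single s s 1

/-- Superoperators on the operators of an `n`-qubit register. -/
abbrev Superop (n : ℕ) : Type := Module.End ℂ (Matrix (Bits n) (Bits n) ℂ)

/-- The map `ρ ↦ K ρ K†`. -/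
def conjBy {m n : Type*} [Fintype m] [Fintype n] (K : Matrix m n ℂ) :
    Matrix n n ℂ →ₗ[ℂ] Matrix m m ℂ where
  toFun ρ := K * ρ * Kᴴ
  map_add' ρ ρ' := by rw [Matrix.mul_add, Matrix.add_mul]
  map_smul' z ρ := by simp

/-- The mixture `ρ ↦ ∑ i, μ i • (op i) ρ (op i)†`; it is the Pauli channel with mixture
probabilities `μ` when `op` is a family of Pauli operators. -/
noncomputable def mixture {ι n : Type*} [Fintype ι] [Fintype n] (op : ι → Matrix n n ℂ)
    (μ : ι → ℝ) : Module.End ℂ (Matrix n n ℂ) :=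
  ∑ i, (μ i : ℂ) • conjBy (op i)

/-- `U` is a Clifford unitary with respect to the Pauli operators `op i`: it is unitary and
conjugation by `U` maps each Pauli operator to plus or minus a Pauli operator. -/
def IsClifford {ι n : Type*} [Fintype n] [DecidableEq n] (op : ι → Matrix n n ℂ)
    (U : Matrix n n ℂ) : Prop :=
  U ∈ Matrix.unitaryGroup n ℂ ∧
    ∀ i, ∃ j, U * op i * Uᴴ = op j ∨ U * op i * Uᴴ = -op j

/-- Pauli operators on two registers. -/
noncomputable def pauli2 {k s : ℕ} (P : Pauli k × Pauli s) :
    Matrix (Bits k × Bits s) (Bits k × Bits s) ℂ :=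
  P.1.mat ⊗ₖ P.2.mat

/-- Pauli operators on three registers. -/
noncomputable def pauli3 {s a o : ℕ} (P : Pauli s × Pauli a × Pauli o) :
    Matrix (Bits s × Bits a × Bits o) (Bits s × Bits a × Bits o) ℂ :=
  P.1.mat ⊗ₖ pauli2 P.2

/-- Pauli operators on the four registers `L`, `S`, `A`, `O`. -/
noncomputable def pauli4 {k s a o : ℕ} (P : Pauli k × Pauli s × Pauli a × Pauli o) :
    Matrix (Bits k × Bits s × Bits a × Bits o) (Bits k × Bits s × Bits a × Bits o) ℂ :=
  P.1.mat ⊗ₖ pauli3 P.2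

/-- Adjoin `A` in the state `|a₀⟩⟨a₀|` and `O` in the state `|0⟩⟨0|` to a state of `L` and `S`. -/
def adjoin {k s a o : ℕ} (a₀ : Bits a) :
    Matrix (Bits k × Bits s) (Bits k × Bits s) ℂ →ₗ[ℂ]
      Matrix (Bits k × Bits s × Bits a × Bits o) (Bits k × Bits s × Bits a × Bits o) ℂ where
  toFun ρ := Matrix.of fun x y =>
    ρ (x.1, x.2.1) (y.1, y.2.1) * proj a₀ x.2.2.1 y.2.2.1 * proj (0 : Bits o) x.2.2.2 y.2.2.2
  map_add' ρ ρ' := by ext x y; simp [add_mul]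
  map_smul' z ρ := by ext x y; simp [mul_assoc]

/-- Discard `A` and `O` (partial trace). -/
def discard {k s a o : ℕ} :
    Matrix (Bits k × Bits s × Bits a × Bits o) (Bits k × Bits s × Bits a × Bits o) ℂ →ₗ[ℂ]
      Matrix (Bits k × Bits s) (Bits k × Bits s) ℂ where
  toFun ρ := Matrix.of fun x y =>
    ∑ u : Bits a, ∑ θ : Bits o, ρ (x.1, x.2, u, θ) (y.1, y.2, u, θ)
  map_add' ρ ρ' := by ext x y; simp [Finset.sum_add_distrib]
  map_smul' z ρ := by ext x y; simp [Finset.mul_sum]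

/-! ### QEC cycles with Pauli-stochastic noise -/

/-- A QEC cycle, in the Clifford frame, of a stabilizer code with `k` logical qubits (register
`L`) and `s` stabilizer generators (register `S`), together with its Pauli-stochastic noise. -/
structure Cycle (k s : ℕ) where
  /-- number of ancilla qubits (register `A`) -/
  a : ℕ
  /-- number of outcome qubits (register `O`) -/
  o : ℕ
  /-- default configuration `s_*` of the syndrome register -/
  sStar : Bits s
  /-- initial state of the ancillas -/
  a₀ : Bits a
  /-- the Clifford unitary `C` on `S`, `A`, `O` that reads out the syndrome information -/
  C : Matrix (Bits s × Bits a × Bits o) (Bits s × Bits a × Bits o) ℂ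
  clifford : IsClifford (pauli3 (s := s) (a := a) (o := o)) C
  /-- syndrome encoding function -/
  E : Bits s → Bits o
  /-- output state of the ancillas -/
  b : Bits s → Bits a
  readout : ∀ t : Bits s,
    conjBy C (proj (t, a₀, (0 : Bits o))) = proj (t, b t, E t)
  /-- syndrome decoding function -/
  D : Bits o → Bits s
  /-- the decoder: the logical Pauli correction for each error syndrome `s_err` -/
  cor : Bits s → Pauli k
  cor_zero : cor 0 = fun _ => Pauli1.I
  /-- mixture probabilities of the Pauli channel that acts directly after `C` -/
  noise : Pauli k × Pauli s × Pauli a × Pauli o → ℝ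
  noise_mem : noise ∈ stdSimplex ℝ (Pauli k × Pauli s × Pauli a × Pauli o)
  /-- whether the cycle is modified by syndrome-state randomization -/
  randomized : Bool

namespace Cycle

variable {k s : ℕ} (c : Cycle k s)

/-- The distribution of the bitstring `s_r` that is added to the syndrome register before the
cycle: uniform with syndrome-state randomization, and `s_r = 0` without. -/
noncomputable def shiftProb (r : Bits s) : ℝ :=
  if c.randomized = true then 1 / 2 ^ s else if r = 0 then 1 else 0

/-- The operation conditioned on the content `θ` of the outcome register. With
`s_err = D θ + s_*`, it resets `S` by `X ^ s_err` and applies the logical recovery for `s_err`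
(for `s_err + s_r` under syndrome-state randomization). -/
noncomputable def feedback (r : Bits s) (θ : Bits c.o) :
    Matrix (Bits k × Bits s × Bits c.a × Bits c.o) (Bits k × Bits s × Bits c.a × Bits c.o) ℂ :=
  (c.cor (c.D θ + c.sStar + r)).mat ⊗ₖ
    ((xPauli (c.D θ + c.sStar)).mat ⊗ₖ
      ((1 : Matrix (Bits c.a) (Bits c.a) ℂ) ⊗ₖ proj θ))

/-- The noisy QEC cycle as a map on the states of `L` and `S`. -/
noncomputable def channel : Module.End ℂ (Matrix (Bits k × Bits s) (Bits k × Bits s) ℂ) :=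
  ∑ r : Bits s, (c.shiftProb r : ℂ) • ∑ θ : Bits c.o,
    discard ∘ₗ conjBy (c.feedback r θ) ∘ₗ mixture pauli4 c.noise ∘ₗ
      conjBy ((1 : Matrix (Bits k) (Bits k) ℂ) ⊗ₖ c.C) ∘ₗ adjoin c.a₀ ∘ₗ
      conjBy ((1 : Matrix (Bits k) (Bits k) ℂ) ⊗ₖ (xPauli r).mat)

/-- The inferred error syndrome `s_err` if the true syndrome is `sIn`, the randomizing bitstring
is `r` and the Pauli error is `P`. -/
def errSyndrome (sIn r : Bits s) (P : Pauli k × Pauli s × Pauli c.a × Pauli c.o) : Bits s :=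
  c.D (c.E (sIn + r) + P.2.2.2.flip) + c.sStar

/-- The syndrome after the cycle. -/
def outSyndrome (sIn r : Bits s) (P : Pauli k × Pauli s × Pauli c.a × Pauli c.o) : Bits s :=
  sIn + r + P.2.1.flip + c.errSyndrome sIn r P

/-- The transition probabilities `γ_{s_out, s_in}` of the syndrome. -/
noncomputable def γ (sOut sIn : Bits s) : ℝ :=
  ∑ r, ∑ P, if c.outSyndrome sIn r P = sOut then c.shiftProb r * c.noise P else 0

/-- The logical Pauli channel `Λ_{s_out, s_in}` conditioned on `s_in` and `s_out`;
it is `0` if `γ_{s_out, s_in} = 0`. -/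
noncomputable def Λ (sOut sIn : Bits s) : Superop k :=
  ((c.γ sOut sIn)⁻¹ : ℂ) • ∑ r, ∑ P,
    ((if c.outSyndrome sIn r P = sOut then c.shiftProb r * c.noise P else 0 : ℝ) : ℂ) •
      (conjBy (c.cor (c.errSyndrome sIn r P + r)).mat ∘ₗ conjBy P.1.mat)

/-- Syndrome marginal independence: `γ_{s_out, s_in}` does not depend on `s_in`. -/
def SyndromeMarginalIndependence : Prop :=
  ∀ sOut sIn sIn' : Bits s, c.γ sOut sIn = c.γ sOut sIn'

/-- The syndrome marginal distribution (meaningful under syndrome marginal independence, where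
the choice of the input syndrome is immaterial). -/
noncomputable def marginal (t : Bits s) : ℝ := c.γ t c.sStar

/-- The operator that corrects the logical error associated with the true syndrome `t`,
that is, with the error syndrome `t + s_*`. -/
noncomputable def corMat (t : Bits s) : Matrix (Bits k) (Bits k) ℂ :=
  (c.cor (t + c.sStar)).mat

/-- The channel `Cor_{s_out} ∘ Λ_{s_out, s_in} ∘ Cor_{s_in}†`. -/
noncomputable def Λtilde (sOut sIn : Bits s) : Superop k :=
  conjBy (c.corMat sOut) ∘ₗ c.Λ sOut sIn ∘ₗ conjBy (c.corMat sIn)ᴴ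

/-- The single-cycle logical error channel. -/
noncomputable def Λ₁ : Superop k :=
  ∑ sOut, ∑ sIn, ((c.marginal sOut * c.marginal sIn : ℝ) : ℂ) • c.Λtilde sOut sIn

/-- The single-cycle logical entanglement fidelity `f₁ = D⁻³ ∑_P tr (P Λ₁(P))`, `D = 2 ^ k`. -/
noncomputable def f₁ : ℝ :=
  (1 / ((2 : ℝ) ^ k) ^ 3) * (∑ P : Pauli k, (P.mat * c.Λ₁ P.mat).trace).re

end Cycle

/-! ### State preparations and measurements with Pauli-stochastic noise -/

/-- A state preparation with Pauli-stochastic noise. -/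
structure Preparation (k s : ℕ) where
  /-- the target logical state -/
  σ : Matrix (Bits k) (Bits k) ℂ
  posSemidef : σ.PosSemidef
  trace_eq_one : σ.trace = 1
  /-- mixture probabilities of the Pauli channel on `L` and `S` that acts on the encoded state -/
  noise : Pauli k × Pauli s → ℝ
  noise_mem : noise ∈ stdSimplex ℝ (Pauli k × Pauli s)

namespace Preparation

variable {k s : ℕ} (p : Preparation k s)

/-- The noisy initial state of `L` and `S` if the default syndrome is `sStar`. -/
noncomputable def state (sStar : Bits s) : Matrix (Bits k × Bits s) (Bits k × Bits s) ℂ :=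
  mixture pauli2 p.noise (p.σ ⊗ₖ proj sStar)

/-- The distribution of the syndrome after the preparation. -/
noncomputable def γ (sStar t : Bits s) : ℝ :=
  ∑ P, if sStar + P.2.flip = t then p.noise P else 0

/-- The logical Pauli channel of the preparation conditioned on the syndrome `t`;
it is `0` if `t` has probability zero. -/
noncomputable def Λ (sStar t : Bits s) : Superop k :=
  ((p.γ sStar t)⁻¹ : ℂ) • ∑ P,
    ((if sStar + P.2.flip = t then p.noise P else 0 : ℝ) : ℂ) • conjBy P.1.mat

end Preparation

/-- A destructive logical measurement with Pauli-stochastic noise. It is a computational-basis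
measurement of `L`, possibly preceded by a logical Clifford unitary `V` absorbed into `C`. -/
structure Measurement (k s : ℕ) where
  /-- number of ancilla qubits -/
  a : ℕ
  /-- number of outcome qubits -/
  o : ℕ
  /-- initial state of the ancillas -/
  a₀ : Bits a
  /-- the logical Clifford unitary that selects the measurement basis -/
  V : Matrix (Bits k) (Bits k) ℂ
  V_clifford : IsClifford (Pauli.mat (n := k)) V
  /-- the Clifford unitary on `L`, `S`, `A`, `O` that writes the measurement data to `O` -/
  C : Matrix (Bits k × Bits s × Bits a × Bits o) (Bits k × Bits s × Bits a × Bits o) ℂ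
  clifford : IsClifford (pauli4 (k := k) (s := s) (a := a) (o := o)) C
  /-- encoding of the outcomes -/
  E : Bits k → Bits s → Bits o
  /-- output state of the ancillas -/
  b : Bits k → Bits s → Bits a
  /-- `C (V† |x⟩ ⊗ |t⟩ ⊗ |a₀⟩ ⊗ |0⟩) = |x⟩ ⊗ |t⟩ ⊗ |b⟩ ⊗ |E(x, t)⟩` -/
  readout : ∀ (x : Bits k) (t : Bits s),
    (C * (Vᴴ ⊗ₖ (1 : Matrix (Bits s × Bits a × Bits o) (Bits s × Bits a × Bits o) ℂ))) *ᵥ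
        Pi.single (x, t, a₀, (0 : Bits o)) 1
      = Pi.single (x, t, b x t, E x t) 1
  /-- extraction of the outcome from the data in `O` -/
  D : Bits o → Bits k
  /-- mixture probabilities of the Pauli channel that acts directly after `C` -/
  noise : Pauli k × Pauli s × Pauli a × Pauli o → ℝ
  noise_mem : noise ∈ stdSimplex ℝ (Pauli k × Pauli s × Pauli a × Pauli o)

namespace Measurement

variable {k s : ℕ} (m : Measurement k s)

/-- The target logical POVM, `M_x = V† |x⟩⟨x| V`. -/
def povm (x : Bits k) : Matrix (Bits k) (Bits k) ℂ := m.Vᴴ * proj x * m.V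

/-- The probability that the noisy measurement of a state `ρ` of `L` and `S` has outcome `x`. -/
noncomputable def prob (ρ : Matrix (Bits k × Bits s) (Bits k × Bits s) ℂ) (x : Bits k) : ℝ :=
  ∑ θ : Bits m.o, if m.D θ = x then
    (((1 : Matrix (Bits k) (Bits k) ℂ) ⊗ₖ
        ((1 : Matrix (Bits s) (Bits s) ℂ) ⊗ₖ ((1 : Matrix (Bits m.a) (Bits m.a) ℂ) ⊗ₖ proj θ))) *
      mixture pauli4 m.noise (conjBy m.C (adjoin m.a₀ ρ))).trace.re
  else 0

/-- The probability of the outcome `x` for the logical basis state `V† |y⟩` and the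
syndrome `t`. -/
noncomputable def kernel (t : Bits s) (x y : Bits k) : ℝ :=
  ∑ P, if m.D (m.E y t + P.2.2.2.flip) = x then m.noise P else 0

/-- The logical channel of the measurement for the syndrome `t`: dephasing in the measurement
basis followed by the classical noise on the outcome. It satisfies
`Prob(x) = tr (M_x Λ_t(ρ))` on the state `ρ ⊗ |t⟩⟨t|`, and it is a Pauli channel whenever the
distribution of the difference of actual and ideal outcome does not depend on the latter. -/
noncomputable def Λ (t : Bits s) : Superop k :=
  ∑ x, ∑ y, (m.kernel t x y : ℂ) • conjBy (m.Vᴴ * Matrix.single x y 1 * m.V)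

end Measurement

/-! ### QEC experiments and logical Markovian models -/

/-- The sum over `s_0, …, s_{K-1}`, for fixed `s_K`, of the terms
`γ_{s_K,s_{K-1}} ⋯ γ_{s_1,s_0} γ^prep_{s_0} • Λ_{s_K,s_{K-1}} ∘ ⋯ ∘ Λ_{s_1,s_0} ∘ Λ^prep_{s_0}`. -/
noncomputable def pathSum {k s : ℕ} (c : Cycle k s) (p : Preparation k s) :
    ℕ → Bits s → Superop k
  | 0, t => (p.γ c.sStar t : ℂ) • p.Λ c.sStar t
  | K + 1, t => ∑ t', (c.γ t t' : ℂ) • (c.Λ t t' ∘ₗ pathSum c p K t')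

/-- The total logical error channel of the experiment with `K` cycles:
the sum over `s_0, …, s_K` of
`γ_{s_K,s_{K-1}} ⋯ γ_{s_1,s_0} γ^prep_{s_0} •
  Λ^meas_{s_K} ∘ Λ_{s_K,s_{K-1}} ∘ ⋯ ∘ Λ_{s_1,s_0} ∘ Λ^prep_{s_0}`. -/
noncomputable def Λtot {k s : ℕ} (c : Cycle k s) (p : Preparation k s) (m : Measurement k s)
    (K : ℕ) : Superop k :=
  ∑ t, m.Λ t ∘ₗ pathSum c p K t

/-- The probability of the outcome `x` in the experiment that consists of the preparation,
`K` repetitions of the cycle and the measurement. -/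
noncomputable def experimentProb {k s : ℕ} (c : Cycle k s) (p : Preparation k s)
    (m : Measurement k s) (K : ℕ) (x : Bits k) : ℝ :=
  m.prob ((c.channel ^ K) (p.state c.sStar)) x

/-- A logical Markovian model: superoperators on `L` for the preparations, for the QEC cycle
(independent of the setting) and for the measurements. -/
structure MarkovModel (k s : ℕ) where
  prep : Preparation k s → Superop k
  qec : Superop k
  meas : Measurement k s → Superop k

/-- The prediction `tr (M_x Φ_meas Φ_QEC ^ K Φ_prep (σ))` of the model. -/
noncomputable def MarkovModel.prediction {k s : ℕ} (M : MarkovModel k s) (p : Preparation k s)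
    (m : Measurement k s) (K : ℕ) (x : Bits k) : ℂ :=
  (m.povm x * M.meas m ((M.qec ^ K) (M.prep p p.σ))).trace

/-- `M` is a `(G, ε)`-approximate logical Markovian model for the set `Exp` of experimental
settings. -/
def MarkovModel.IsApprox {k s : ℕ} (M : MarkovModel k s) (c : Cycle k s)
    (Exp : Set (Preparation k s × Measurement k s)) (G ε : ℝ) : Prop :=
  0 < G ∧ 0 < ε ∧ ε < 1 ∧
    ∀ e ∈ Exp, ∀ K : ℕ, 0 < K → ∀ x : Bits k,
      ‖(e.2.povm x * Λtot c e.1 e.2 K e.1.σ).trace - M.prediction e.1 e.2 K x‖ ≤ G * ε ^ K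

end QEC

/-! Every logical channel of the preparation and of the cycle is diagonal in the Pauli basis, so for
each Pauli operator `Q` the sum over syndrome histories is scalar. Write γ for the syndrome marginal
and λ for the eigenvalues at `Q`. Because the transition probabilities do not depend on the input
syndrome, the weights can be split evenly between both ends of a transition, and the sum over
histories becomes a power of the matrix T_Q with entries √γ_t √γ_t' λ_{tt'}(Q), applied to a vector
of norm at most 1 (`pathSum_mat`, `norm_prepVector_le`).

If the decoder always succeeded, λ_{tt'}(Q) would be a product χ_t χ_t' of correction signs and T_Q
the orthogonal projection onto the unit vector (√γ_t χ_t). In general the squared Frobenius distance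
from this projection is at most 2(1 - λ₁(Q)), with λ₁ the eigenvalue of the single-cycle channel. A
fixed error contributes to λ₁ a ±1-valued character of the Pauli group, which is either trivial or
has mean zero; hence 1 - λ₁(Q) ≤ 2(1 - f₁), and T_Q lies within 2√ε₁ ≤ 1/4 of a rank-one projection
(`one_sub_eigenvalue₁_le`, `norm_transfer_sub_le`).

Such a matrix has a leading eigenvalue μ with right and left eigenvectors r and l, and its powers
differ from those of the leading part by a term that decays like ε^K (`exists_rankOne_approx_pow`).
The model keeps the leading part: μ is the eigenvalue of the cycle at `Q`, l is absorbed into the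
preparation, and r into the measurement (`spectralModel`).

The errors for the individual `Q` are combined by Cauchy–Schwarz and Parseval, at the cost of a
factor √D (`norm_trace_sub_prediction_le`). Separately, `experimentProb_eq` identifies the outcome
statistics of the physical circuit with those of the total logical error channel. -/

namespace QEC

/-! ### Perturbation of a rank-one projection in a real Hilbert space. -/

section RankOnePerturbation

open scoped InnerProductSpace

variable {H : Type*} [NormedAddCommGroup H] [InnerProductSpace ℝ H]

/-- Two-sided bound for `⟪v, w⟫` if `μ w = v + E w` with `‖E w‖ ≤ δ ‖w‖`. -/
lemma inner_bounds_of_resolvent {v w e : H} {μ δ : ℝ} (hv : ‖v‖ = 1) (hδ : 0 ≤ δ) (hμ : δ < μ)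
    (hw : μ • w = v + e) (he : ‖e‖ ≤ δ * ‖w‖) :
    1 / (μ + δ) ≤ ⟪v, w⟫_ℝ ∧ ⟪v, w⟫_ℝ ≤ 1 / (μ - δ) := by
  have hμ0 : 0 < μ := hδ.trans_lt hμ
  have he' : e = μ • w - v := by rw [hw]; abel
  have hsq : ‖e‖ ^ 2 = μ ^ 2 * ‖w‖ ^ 2 - 2 * μ * ⟪v, w⟫_ℝ + 1 := by
    rw [he', norm_sub_sq_real, norm_smul, hv, inner_smul_left, real_inner_comm]
    simp [mul_pow]; ring
  have hsq' : ‖e‖ ^ 2 ≤ δ ^ 2 * ‖w‖ ^ 2 := by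
    rw [← mul_pow]; exact pow_le_pow_left₀ (norm_nonneg _) he 2
  have hupper : μ * ‖w‖ ≤ 1 + δ * ‖w‖ := by
    calc μ * ‖w‖ = ‖μ • w‖ := by rw [norm_smul, Real.norm_of_nonneg hμ0.le]
      _ ≤ ‖v‖ + ‖e‖ := by rw [hw]; exact norm_add_le _ _
      _ ≤ _ := by rw [hv]; linarith
  have hlower : 1 ≤ (μ + δ) * ‖w‖ := by
    calc 1 = ‖μ • w - e‖ := by rw [hw, add_sub_cancel_right, hv]
      _ ≤ ‖μ • w‖ + ‖e‖ := norm_sub_le _ _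
      _ ≤ _ := by rw [norm_smul, Real.norm_of_nonneg hμ0.le]; linarith
  have hin : ⟪v, w⟫_ℝ ≤ ‖w‖ := by simpa [hv] using real_inner_le_norm v w
  constructor
  -- Expanding the square gives (μ² - δ²)‖w‖² ≤ 2μ⟪v, w⟫ - 1; inserting ‖w‖ ≥ 1/(μ + δ) leaves
  -- exactly the claimed bound.
  · rw [div_le_iff₀ (by linarith)]
    have h2 : 1 ≤ (μ + δ) ^ 2 * ‖w‖ ^ 2 := by nlinarith
    have h3 : (μ - δ) ≤ (μ - δ) * ((μ + δ) ^ 2 * ‖w‖ ^ 2) := by nlinarith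
    nlinarith
  · rw [le_div_iff₀ (by linarith)]
    nlinarith

/-- With the normalization ⟪v, w⟫ = 1 the squared estimate reads ‖w‖² ≤ (2μ - 1)/(μ² - δ²). The
right side is at most 4(2 - √3) ≈ 1.072, attained at δ = 1/4, and 13/12 is a rational bound for it.
-/
lemma norm_sq_le_of_inner_eq_one {v w e : H} {μ δ : ℝ} (hv : ‖v‖ = 1) (hδ : 0 ≤ δ)
    (hδ' : δ ≤ 1 / 4) (hμ : δ < μ) (hw : μ • w = v + e) (he : ‖e‖ ≤ δ * ‖w‖)
    (hvw : ⟪v, w⟫_ℝ = 1) : ‖w‖ ^ 2 ≤ 13 / 12 := by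
  have he' : e = μ • w - v := by rw [hw]; abel
  have hsq : ‖e‖ ^ 2 = μ ^ 2 * ‖w‖ ^ 2 - 2 * μ * ⟪v, w⟫_ℝ + 1 := by
    rw [he', norm_sub_sq_real, norm_smul, hv, inner_smul_left, real_inner_comm]
    simp [mul_pow]; ring
  have hsq' : ‖e‖ ^ 2 ≤ δ ^ 2 * ‖w‖ ^ 2 := by
    rw [← mul_pow]; exact pow_le_pow_left₀ (norm_nonneg _) he 2
  rw [hvw] at hsq
  have h1 : (μ ^ 2 - δ ^ 2) * ‖w‖ ^ 2 ≤ 2 * μ - 1 := by nlinarith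
  have hpos : 0 < μ ^ 2 - δ ^ 2 := by nlinarith
  have h2 : 2 * μ - 1 ≤ (μ ^ 2 - δ ^ 2) * (13 / 12) := by
    nlinarith [sq_nonneg (μ - 12 / 13)]
  exact le_of_mul_le_mul_left (h1.trans h2) hpos

variable [CompleteSpace H]

/-- The leading eigenvalue and eigenvectors of a small perturbation of the orthogonal
projection onto a unit vector `v`. -/
lemma exists_leading_eigenvectors (v : H) (hv : ‖v‖ = 1) (E : H →L[ℝ] H) {δ : ℝ} (hδ : 0 ≤ δ)
    (hδ' : δ ≤ 1 / 4) (hE : ‖E‖ ≤ δ) :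
    ∃ (μ : ℝ) (r l : H), μ • r = v + E r ∧ μ • l = v + E.adjoint l ∧ ⟪v, r⟫_ℝ = 1 ∧
      ⟪v, l⟫_ℝ = 1 ∧ ‖r‖ ^ 2 ≤ 13 / 12 ∧ ‖l‖ ^ 2 ≤ 13 / 12 := by
  have : Nontrivial H := ⟨v, 0, by rintro rfl; simp at hv⟩
  have hres : ∀ μ ∈ Set.Icc (1 - δ) (1 + δ), μ ∈ resolventSet ℝ E := by
    intro μ hμ
    apply spectrum.mem_resolventSet_of_norm_lt
    rw [Real.norm_of_nonneg (by linarith [hμ.1])]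
    linarith [hμ.1]
  have hunit : ∀ μ ∈ Set.Icc (1 - δ) (1 + δ),
      (algebraMap ℝ (H →L[ℝ] H) μ - E) * resolvent E μ = 1 ∧
      resolvent E μ * (algebraMap ℝ (H →L[ℝ] H) μ - E) = 1 := by
    intro μ hμ
    have h := hres μ hμ
    rw [spectrum.mem_resolventSet_iff] at h
    exact ⟨Ring.mul_inverse_cancel _ h, Ring.inverse_mul_cancel _ h⟩
  have hright : ∀ μ ∈ Set.Icc (1 - δ) (1 + δ), μ • resolvent E μ v = v + E (resolvent E μ v) := by
    intro μ hμ
    have h := DFunLike.congr_fun (hunit μ hμ).1 v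
    simp only [mul_apply_eq_comp, sub_apply,
      ContinuousLinearMap.algebraMap_apply, one_apply_eq_self] at h
    rw [← sub_eq_iff_eq_add]; exact h
  have hbound : ∀ w, ‖E w‖ ≤ δ * ‖w‖ := fun w => E.le_of_opNorm_le hE w
  have hbound' : ∀ w, ‖E.adjoint w‖ ≤ δ * ‖w‖ := fun w =>
    E.adjoint.le_of_opNorm_le (by rwa [LinearIsometryEquiv.norm_map]) w
  have hcont : ContinuousOn (fun μ : ℝ => ⟪v, resolvent E μ v⟫_ℝ) (Set.Icc (1 - δ) (1 + δ)) := by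
    intro μ hμ
    have h1 : ContinuousAt (resolvent E) μ :=
      (spectrum.hasDerivAt_resolvent_const_left (hres μ hμ)).continuousAt
    have h2 : ContinuousAt (fun μ : ℝ => resolvent E μ v) μ :=
      h1.clm_apply continuousAt_const
    exact (continuousAt_const.inner h2).continuousWithinAt
  have hle : 1 - δ ≤ 1 + δ := by linarith
  have hlo := inner_bounds_of_resolvent hv hδ (by linarith)
    (hright (1 - δ) ⟨le_rfl, hle⟩) (hbound _)
  have hhi := inner_bounds_of_resolvent hv hδ (by linarith)
    (hright (1 + δ) ⟨hle, le_rfl⟩) (hbound _)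
  -- A solution of ⟪v, (μ - E)⁻¹ v⟫ = 1 makes (μ - E)⁻¹ v an eigenvector of vvᵀ + E for μ. The
  -- endpoints 1 ± δ are chosen so that the two-sided resolvent bounds become exactly 1 there.
  have hmem : (1 : ℝ) ∈ Set.Icc ⟪v, resolvent E (1 + δ) v⟫_ℝ ⟪v, resolvent E (1 - δ) v⟫_ℝ := by
    constructor
    · simpa using hhi.2
    · simpa using hlo.1
  obtain ⟨μ, hμ, hμ1⟩ := intermediate_value_Icc' hle hcont hmem
  -- The same μ serves for the left eigenvector: the adjoint resolvent has the same matrix element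
  -- at `v`, and the other one-sided inverse identity is the one that dualizes.
  have hl : μ • (resolvent E μ).adjoint v = v + E.adjoint ((resolvent E μ).adjoint v) := by
    rw [← sub_eq_iff_eq_add]
    refine ext_inner_right ℝ fun y => ?_
    have h := DFunLike.congr_fun (hunit μ hμ).2 y
    simp only [mul_apply_eq_comp, sub_apply,
      ContinuousLinearMap.algebraMap_apply, one_apply_eq_self] at h
    rw [inner_sub_left, inner_smul_left, ContinuousLinearMap.adjoint_inner_left,
      ContinuousLinearMap.adjoint_inner_left, ContinuousLinearMap.adjoint_inner_left]
    conv_rhs => rw [← h]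
    rw [map_sub, map_smul, inner_sub_right, inner_smul_right]
    simp
  have hvl : ⟪v, (resolvent E μ).adjoint v⟫_ℝ = 1 := by
    rw [ContinuousLinearMap.adjoint_inner_right, real_inner_comm]; exact hμ1
  have hδμ : δ < μ := by linarith [hμ.1]
  exact ⟨μ, _, _, hright μ hμ, hl, hμ1, hvl,
    norm_sq_le_of_inner_eq_one hv hδ hδ' hδμ (hright μ hμ) (hbound _) hμ1,
    norm_sq_le_of_inner_eq_one hv hδ hδ' hδμ hl (hbound' _) hvl⟩

/-- Powers of a small perturbation of a rank-one orthogonal projection are close to the powers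
of its leading eigenvalue times a rank-one operator. -/
theorem exists_rankOne_approx_pow (v : H) (hv : ‖v‖ = 1) (T : H →L[ℝ] H) {δ : ℝ}
    (hδ : 0 ≤ δ) (hδ' : δ ≤ 1 / 4) (hT : ∀ x, ‖T x - ⟪v, x⟫_ℝ • v‖ ≤ δ * ‖x‖) :
    ∃ (μ : ℝ) (r l : H), ∀ (K : ℕ), 0 < K → ∀ x : H,
      ‖(T ^ K) x - μ ^ K • ⟪l, x⟫_ℝ • r‖ ≤ 2 * ((1 + √2) * δ) ^ K * ‖x‖ := by
  set E : H →L[ℝ] H := T - (innerSL ℝ v).smulRight v with hEdef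
  have hEx : ∀ x, E x = T x - ⟪v, x⟫_ℝ • v := fun x => by simp [hEdef]
  have hTx : ∀ x, T x = ⟪v, x⟫_ℝ • v + E x := fun x => by rw [hEx]; abel
  have hE : ‖E‖ ≤ δ := E.opNorm_le_bound hδ fun x => by rw [hEx]; exact hT x
  obtain ⟨μ, r, l, hr, hl, hvr, hvl, hrn, hln⟩ := exists_leading_eigenvectors v hv E hδ hδ' hE
  have hTr : T r = μ • r := by rw [hTx, hvr, one_smul, hr]
  -- Since ⟪v, r⟫ = ⟪v, l⟫ = 1, the deviations r - v and l - v are orthogonal to v; each has squared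
  -- norm at most 1/12, and ⟪l, r⟫ - 1 is their inner product.
  have hrl : 11 / 12 ≤ ⟪l, r⟫_ℝ := by
    have h1 : ‖l - v‖ ^ 2 ≤ 1 / 12 := by
      rw [norm_sub_sq_real, real_inner_comm, hvl, hv]; linarith
    have h2 : ‖r - v‖ ^ 2 ≤ 1 / 12 := by
      rw [norm_sub_sq_real, real_inner_comm, hvr, hv]; linarith
    have h3 : ⟪l - v, r - v⟫_ℝ = ⟪l, r⟫_ℝ - 1 := by
      rw [inner_sub_left, inner_sub_right, inner_sub_right, hvr, real_inner_comm v l, hvl,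
        real_inner_self_eq_norm_sq, hv]
      ring
    have h4 := abs_real_inner_le_norm (l - v) (r - v)
    rw [h3] at h4
    nlinarith [neg_abs_le (⟪l, r⟫_ℝ - 1), sq_nonneg (‖l - v‖ - ‖r - v‖)]
  have hlr0 : 0 < ⟪l, r⟫_ℝ := by linarith
  have hlx : ∀ x, μ * ⟪l, x⟫_ℝ = ⟪v, x⟫_ℝ + ⟪l, E x⟫_ℝ := by
    intro x
    have := congrArg (fun z => ⟪z, x⟫_ℝ) hl
    simpa [inner_smul_left, inner_add_left, ContinuousLinearMap.adjoint_inner_left] using this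
  have hlv : ⟪l, v⟫_ℝ = 1 := by rw [real_inner_comm]; exact hvl
  have hlT : ∀ x, ⟪l, T x⟫_ℝ = μ * ⟪l, x⟫_ℝ := by
    intro x; rw [hTx, inner_add_right, inner_smul_right, hlv, hlx]; ring
  have hlnorm : ‖l‖ ≤ 1.041 := by nlinarith [norm_nonneg l]
  -- On the kernel of l the left eigenvector equation turns the component along v into -⟪l, E x⟫, so
  -- T x is controlled by E alone, with factor 1 + ‖l‖.
  have hstep : ∀ x, ⟪l, x⟫_ℝ = 0 → ‖T x‖ ≤ 2.041 * δ * ‖x‖ := by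
    intro x hx
    have h1 : ⟪v, x⟫_ℝ = -⟪l, E x⟫_ℝ := by have := hlx x; rw [hx] at this; linarith
    have h2 : ‖E x‖ ≤ δ * ‖x‖ := E.le_of_opNorm_le hE x
    have h3 : |⟪l, E x⟫_ℝ| ≤ ‖l‖ * ‖E x‖ := abs_real_inner_le_norm _ _
    calc ‖T x‖ ≤ |⟪l, E x⟫_ℝ| + ‖E x‖ := by
          rw [hTx, h1]
          refine (norm_add_le _ _).trans ?_
          rw [norm_smul, hv, Real.norm_eq_abs, abs_neg, mul_one]
      _ ≤ 2.041 * ‖E x‖ := by nlinarith [norm_nonneg (E x)]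
      _ ≤ _ := by linarith
  have hpow : ∀ (K : ℕ) (x : H), ⟪l, x⟫_ℝ = 0 →
      ⟪l, (T ^ K) x⟫_ℝ = 0 ∧ ‖(T ^ K) x‖ ≤ (2.041 * δ) ^ K * ‖x‖ := by
    intro K x hx
    induction K with
    | zero => simp [hx]
    | succ K ih =>
      rw [pow_succ' T, mul_apply_eq_comp]
      refine ⟨by rw [hlT, ih.1, mul_zero], (hstep _ ih.1).trans ?_⟩
      rw [pow_succ', mul_assoc (2.041 * δ)]
      exact mul_le_mul_of_nonneg_left ih.2 (by positivity)
  have hTKr : ∀ K : ℕ, (T ^ K) r = μ ^ K • r := by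
    intro K
    induction K with
    | zero => simp
    | succ K ih =>
      rw [pow_succ' T, mul_apply_eq_comp, ih, map_smul, hTr, smul_smul, pow_succ]
  -- The rescaling makes x ↦ ⟪l, x⟫ r the spectral projection, so the error is T ^ K applied to a
  -- vector in the invariant kernel of l.
  refine ⟨μ, r, (⟪l, r⟫_ℝ)⁻¹ • l, fun K hK x => ?_⟩
  set y := x - (⟪l, x⟫_ℝ / ⟪l, r⟫_ℝ) • r with hy
  have hly : ⟪l, y⟫_ℝ = 0 := by
    rw [hy, inner_sub_right, inner_smul_right, div_mul_cancel₀ _ hlr0.ne', sub_self]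
  have hyx : (T ^ K) x - μ ^ K • ⟪(⟪l, r⟫_ℝ)⁻¹ • l, x⟫_ℝ • r = (T ^ K) y := by
    rw [hy, map_sub, map_smul, hTKr, inner_smul_left, smul_smul, smul_smul]
    congr 2
    simp; ring
  have hynorm : ‖y‖ ≤ 24 / 11 * ‖x‖ := by
    have h1 : ‖(⟪l, x⟫_ℝ / ⟪l, r⟫_ℝ) • r‖ ≤ 13 / 11 * ‖x‖ := by
      rw [norm_smul, norm_div, Real.norm_eq_abs, Real.norm_of_nonneg hlr0.le, div_mul_eq_mul_div,
        div_le_iff₀ hlr0]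
      have h2 := abs_real_inner_le_norm l x
      have h3 : ‖l‖ * ‖r‖ ≤ 13 / 12 := by nlinarith [sq_nonneg (‖l‖ - ‖r‖)]
      calc |⟪l, x⟫_ℝ| * ‖r‖ ≤ ‖l‖ * ‖x‖ * ‖r‖ := by gcongr
        _ = ‖l‖ * ‖r‖ * ‖x‖ := by ring
        _ ≤ 13 / 12 * ‖x‖ := by gcongr
        _ = 13 / 11 * ‖x‖ * (11 / 12) := by ring
        _ ≤ _ := by gcongr
    calc ‖y‖ ≤ ‖x‖ + 13 / 11 * ‖x‖ := (norm_sub_le _ _).trans (by linarith)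
      _ = _ := by ring
  have hs2 : (1.4 : ℝ) ≤ √2 := Real.le_sqrt_of_sq_le (by norm_num)
  -- The gap between 2.041 and 1 + √2 absorbs the excess of 24/11 over 2, but only once a factor is
  -- available: the bound fails at K = 0.
  have hnum : (24 / 11 : ℝ) * 2.041 ^ K ≤ 2 * (1 + √2) ^ K := by
    obtain ⟨n, rfl⟩ := Nat.exists_eq_succ_of_ne_zero hK.ne'
    have h1 : (2.041 : ℝ) ^ n ≤ (1 + √2) ^ n := pow_le_pow_left₀ (by norm_num) (by linarith) n
    rw [Nat.succ_eq_add_one, pow_succ, pow_succ]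
    have h2 : (0 : ℝ) ≤ 2.041 ^ n := by positivity
    nlinarith
  rw [hyx]
  calc ‖(T ^ K) y‖ ≤ (2.041 * δ) ^ K * ‖y‖ := (hpow K y hly).2
    _ ≤ (2.041 * δ) ^ K * (24 / 11 * ‖x‖) := by gcongr
    _ = (24 / 11 * 2.041 ^ K) * (δ ^ K * ‖x‖) := by rw [mul_pow]; ring
    _ ≤ (2 * (1 + √2) ^ K) * (δ ^ K * ‖x‖) := by gcongr
    _ = _ := by rw [mul_pow]; ring

end RankOnePerturbation

/-! ### Algebra of Pauli operators -/

lemma conjBy_apply {m n : Type*} [Fintype m] [Fintype n] (K : Matrix m n ℂ) (ρ : Matrix n n ℂ) :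
    conjBy K ρ = K * ρ * Kᴴ := rfl

namespace Pauli1

/-- The sign `±1` by which two single-qubit Pauli operators commute. -/
def sgn (A Q : Pauli1) : ℤ := if A = .I ∨ Q = .I ∨ A = Q then 1 else -1

/-- Multiplication of single-qubit Pauli operators up to a phase. -/
def mul : Pauli1 → Pauli1 → Pauli1
  | .I, Q => Q
  | .X, .I => .X
  | .X, .X => .I
  | .X, .Y => .Z
  | .X, .Z => .Y
  | .Y, .I => .Y
  | .Y, .X => .Z
  | .Y, .Y => .I
  | .Y, .Z => .X
  | .Z, .I => .Z
  | .Z, .X => .Y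
  | .Z, .Y => .X
  | .Z, .Z => .I

lemma sgn_mul : ∀ A Q R : Pauli1, sgn A (mul Q R) = sgn A Q * sgn A R := by
  rintro (_ | _ | _ | _) (_ | _ | _ | _) (_ | _ | _ | _) <;> decide

lemma mul_mul_cancel : ∀ Q R : Pauli1, mul (mul Q R) R = Q := by
  rintro (_ | _ | _ | _) (_ | _ | _ | _) <;> rfl

lemma sgn_eq (A Q : Pauli1) : sgn A Q = 1 ∨ sgn A Q = -1 := by
  unfold sgn; split_ifs <;> simp

lemma sum_univ {M : Type*} [AddCommMonoid M] (f : Pauli1 → M) :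
    ∑ A, f A = f .I + (f .X + (f .Y + f .Z)) := by
  change ∑ A ∈ ({.I, .X, .Y, .Z} : Finset Pauli1), f A = _
  rw [Finset.sum_insert (by decide), Finset.sum_insert (by decide),
    Finset.sum_insert (by decide), Finset.sum_singleton]

/-- Splits bits into the literals 0 and 1, so that the single-qubit identities reduce to entries
that `simp` evaluates. -/
lemma forall_bit {p : ZMod 2 → Prop} (h0 : p 0) (h1 : p 1) : ∀ a, p a := by
  intro a; fin_cases a <;> assumption

lemma sum_bit {M : Type*} [AddCommMonoid M] (f : ZMod 2 → M) : ∑ a, f a = f 0 + f 1 :=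
  Fin.sum_univ_two f

/-- Each column of a Pauli matrix has a single nonzero entry, of modulus one. This is the one-qubit
form of the action on basis projectors. -/
lemma mat_apply_mul_star (A : Pauli1) (a b t : ZMod 2) :
    A.mat a t * star (A.mat b t) = if a = t + A.flip ∧ b = t + A.flip then 1 else 0 := by
  have h2 : (1 : ZMod 2) + 1 = 0 := by decide
  revert a b t
  rcases A with _ | _ | _ | _ <;>
  refine forall_bit (forall_bit (forall_bit ?_ ?_) (forall_bit ?_ ?_))
    (forall_bit (forall_bit ?_ ?_) (forall_bit ?_ ?_)) <;>
  simp [mat, flip, h2]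

lemma conjTranspose_mat (A : Pauli1) : A.matᴴ = A.mat := by
  have h2 : (1 : ZMod 2) + 1 = 0 := by decide
  ext a b
  revert a b
  rcases A with _ | _ | _ | _ <;>
  refine forall_bit (forall_bit ?_ ?_) (forall_bit ?_ ?_) <;>
  simp [mat, Matrix.conjTranspose_apply, h2]

lemma mat_mul_mat_mul_mat (A Q : Pauli1) :
    A.mat * Q.mat * A.mat = (sgn A Q : ℂ) • Q.mat := by
  have h2 : (1 : ZMod 2) + 1 = 0 := by decide
  ext a b
  revert a b
  rcases A with _ | _ | _ | _ <;> rcases Q with _ | _ | _ | _ <;>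
  refine forall_bit (forall_bit ?_ ?_) (forall_bit ?_ ?_) <;>
  simp [mat, sgn, Matrix.mul_apply, sum_bit, h2]

lemma mat_mul_self (A : Pauli1) : A.mat * A.mat = 1 := by
  have h := mat_mul_mat_mul_mat A .I
  simpa [mat, sgn] using h

/-- Completeness: the sum of A ⊗ A over the Pauli matrices is twice the swap. Its `n`-qubit version
yields the expansion of operators in the Pauli basis. -/
lemma sum_mat_mul_mat (a b c d : ZMod 2) :
    ∑ A : Pauli1, A.mat a b * A.mat c d = if a = d ∧ b = c then 2 else 0 := by
  have h2 : (1 : ZMod 2) + 1 = 0 := by decide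
  rw [sum_univ]
  revert a b c d
  refine forall_bit (forall_bit (forall_bit (forall_bit ?_ ?_) (forall_bit ?_ ?_))
    (forall_bit (forall_bit ?_ ?_) (forall_bit ?_ ?_)))
    (forall_bit (forall_bit (forall_bit ?_ ?_) (forall_bit ?_ ?_))
    (forall_bit (forall_bit ?_ ?_) (forall_bit ?_ ?_))) <;>
  simp [mat, h2] <;> norm_num

lemma trace_mat_mul_mat (P Q : Pauli1) :
    (P.mat * Q.mat).trace = if P = Q then 2 else 0 := by
  have h2 : (1 : ZMod 2) + 1 = 0 := by decide
  simp only [Matrix.trace, Matrix.diag_apply, Matrix.mul_apply, sum_bit]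
  rcases P with _ | _ | _ | _ <;> rcases Q with _ | _ | _ | _ <;>
  simp [mat, h2] <;> norm_num

end Pauli1

/-- Distributivity, in the form that reduces identities on `n` qubits to single-qubit ones. -/
lemma sum_prod_bits {n : ℕ} {ι : Type*} [Fintype ι] (f : Fin n → ι → ℂ) :
    ∑ x : Fin n → ι, ∏ j, f j (x j) = ∏ j, ∑ a, f j a := by
  classical
  rw [Finset.prod_univ_sum, Fintype.piFinset_univ]

lemma prod_ite_one_zero {n : ℕ} (p : Fin n → Prop) [∀ j, Decidable (p j)] (z : ℂ) :
    ∏ j, (if p j then z else 0) = if ∀ j, p j then z ^ n else 0 := by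
  split_ifs with h
  · simp [h]
  · push Not at h
    obtain ⟨j, hj⟩ := h
    exact Finset.prod_eq_zero (Finset.mem_univ j) (by simp [hj])

namespace Pauli

variable {n : ℕ}

/-- The sign `±1` by which two Pauli operators commute. -/
noncomputable def sgn (A Q : Pauli n) : ℝ := ∏ j, (Pauli1.sgn (A j) (Q j) : ℝ)

/-- Multiplication of Pauli operators up to a phase. -/
def mul (Q R : Pauli n) : Pauli n := fun j => (Q j).mul (R j)

lemma sgn_mul (A Q R : Pauli n) : sgn A (mul Q R) = sgn A Q * sgn A R := by
  simp [sgn, mul, Pauli1.sgn_mul, Finset.prod_mul_distrib]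

/-- Multiplication by `R` as a permutation of the Pauli operators. -/
def mulEquiv (R : Pauli n) : Pauli n ≃ Pauli n where
  toFun Q := mul Q R
  invFun Q := mul Q R
  left_inv _ := funext fun _ => Pauli1.mul_mul_cancel _ _
  right_inv _ := funext fun _ => Pauli1.mul_mul_cancel _ _

lemma sgn_mul_self (A Q : Pauli n) : sgn A Q * sgn A Q = 1 := by
  rw [sgn, ← Finset.prod_mul_distrib]
  refine Finset.prod_eq_one fun j _ => ?_
  rcases Pauli1.sgn_eq (A j) (Q j) with h | h <;> simp [h]

lemma sgn_eq (A Q : Pauli n) : sgn A Q = 1 ∨ sgn A Q = -1 :=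
  mul_self_eq_one_iff.1 (sgn_mul_self A Q)

lemma mat_mul_apply (P Q : Pauli n) (x y : Bits n) :
    (P.mat * Q.mat) x y = ∏ j, ((P j).mat * (Q j).mat) (x j) (y j) := by
  simp only [Matrix.mul_apply, mat, Matrix.of_apply, ← Finset.prod_mul_distrib]
  exact sum_prod_bits (fun j a => (P j).mat (x j) a * (Q j).mat a (y j))

lemma mat_mul_mul_apply (P Q R : Pauli n) (x y : Bits n) :
    (P.mat * Q.mat * R.mat) x y =
      ∏ j, ((P j).mat * (Q j).mat * (R j).mat) (x j) (y j) := by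
  rw [Matrix.mul_apply]
  simp only [mat_mul_apply]
  simp only [mat, Matrix.of_apply, ← Finset.prod_mul_distrib]
  rw [sum_prod_bits (fun j a => ((P j).mat * (Q j).mat) (x j) a * (R j).mat a (y j))]
  simp only [← Matrix.mul_apply]

lemma conjTranspose_mat (P : Pauli n) : P.matᴴ = P.mat := by
  ext x y
  simp only [Matrix.conjTranspose_apply, mat, Matrix.of_apply, star_prod]
  refine Finset.prod_congr rfl fun j _ => ?_
  rw [← Matrix.conjTranspose_apply, Pauli1.conjTranspose_mat]

lemma mat_mul_self (P : Pauli n) : P.mat * P.mat = 1 := by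
  ext x y
  rw [mat_mul_apply]
  simp only [Pauli1.mat_mul_self, Matrix.one_apply]
  rw [prod_ite_one_zero]
  simp [funext_iff]

lemma conjBy_mat (P Q : Pauli n) : conjBy P.mat Q.mat = (sgn P Q : ℂ) • Q.mat := by
  ext x y
  rw [conjBy_apply, conjTranspose_mat, mat_mul_mul_apply]
  simp only [Pauli1.mat_mul_mat_mul_mat, Matrix.smul_apply, smul_eq_mul,
    Finset.prod_mul_distrib]
  simp [sgn, mat]

lemma trace_mat_mul_mat (P Q : Pauli n) :
    (P.mat * Q.mat).trace = if P = Q then 2 ^ n else 0 := by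
  simp only [Matrix.trace, Matrix.diag_apply, mat_mul_apply]
  rw [sum_prod_bits (fun j a => ((P j).mat * (Q j).mat) a a)]
  have := fun j => Pauli1.trace_mat_mul_mat (P j) (Q j)
  simp only [Matrix.trace, Matrix.diag_apply] at this
  simp only [this]
  rw [prod_ite_one_zero]
  simp [funext_iff]

lemma sum_mat_mul_mat (x y z w : Bits n) :
    ∑ P : Pauli n, P.mat x y * P.mat z w = if x = w ∧ y = z then 2 ^ n else 0 := by
  simp only [mat, Matrix.of_apply, ← Finset.prod_mul_distrib]
  rw [sum_prod_bits (fun j (A : Pauli1) => A.mat (x j) (y j) * A.mat (z j) (w j))]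
  simp only [Pauli1.sum_mat_mul_mat]
  rw [prod_ite_one_zero]
  simp [funext_iff, forall_and]

/-- Every operator is a linear combination of Pauli operators. -/
lemma sum_trace_smul_mat (A : Matrix (Bits n) (Bits n) ℂ) :
    ∑ P : Pauli n, (P.mat * A).trace • P.mat = (2 : ℂ) ^ n • A := by
  ext x y
  simp only [Matrix.sum_apply, Matrix.smul_apply, smul_eq_mul, Matrix.trace, Matrix.diag_apply,
    Matrix.mul_apply, Finset.sum_mul]
  rw [Finset.sum_comm]
  have : ∀ i, ∑ P : Pauli n, ∑ j, P.mat i j * A j i * P.mat x y =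
      ∑ j, (if i = y ∧ j = x then 2 ^ n else 0) * A j i := by
    intro i
    rw [Finset.sum_comm]
    refine Finset.sum_congr rfl fun j _ => ?_
    rw [← sum_mat_mul_mat, Finset.sum_mul]
    exact Finset.sum_congr rfl fun P _ => by ring
  simp only [this, ite_mul, zero_mul, ite_and]
  simp

lemma eq_sum_mat (A : Matrix (Bits n) (Bits n) ℂ) :
    A = ∑ P : Pauli n, (((2 : ℂ) ^ n)⁻¹ * (P.mat * A).trace) • P.mat := by
  simp only [mul_smul, ← Finset.smul_sum, sum_trace_smul_mat]
  rw [smul_smul, inv_mul_cancel₀ (by positivity), one_smul]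

/-- Parseval's identity for the Pauli basis. -/
lemma sum_norm_sq_trace {A : Matrix (Bits n) (Bits n) ℂ} (hA : A.IsHermitian) :
    ((∑ P : Pauli n, ‖(P.mat * A).trace‖ ^ 2 : ℝ) : ℂ) = 2 ^ n * (A * A).trace := by
  have h := congrArg (fun B => (B * A).trace) (sum_trace_smul_mat A)
  simp only [Matrix.sum_mul, Matrix.trace_sum, Matrix.smul_mul, Matrix.trace_smul,
    smul_eq_mul] at h
  rw [← h]
  push_cast
  refine Finset.sum_congr rfl fun P _ => ?_
  -- Both factors are Hermitian, so the trace is real and its square is its squared modulus.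
  have hr : star (P.mat * A).trace = (P.mat * A).trace := by
    rw [← Matrix.trace_conjTranspose, Matrix.conjTranspose_mul, hA.eq, conjTranspose_mat,
      Matrix.trace_mul_comm]
  have h2 := Complex.mul_conj' (P.mat * A).trace
  rw [← h2, starRingEnd_apply, hr]

lemma conjBy_proj (P : Pauli n) (t : Bits n) : conjBy P.mat (proj t) = proj (t + P.flip) := by
  ext x y
  have h1 : (P.mat * proj t * P.matᴴ) x y = P.mat x t * star (P.mat y t) := by
    simp [proj, Matrix.mul_apply, Matrix.single_apply, ite_and]
  rw [conjBy_apply, h1]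
  simp only [mat, Matrix.of_apply, star_prod, ← Finset.prod_mul_distrib,
    Pauli1.mat_apply_mul_star]
  rw [prod_ite_one_zero]
  simp only [proj, Matrix.single_apply, one_pow, forall_and, funext_iff, flip, Pi.add_apply,
    eq_comm]

lemma flip_xPauli (t : Bits n) : (xPauli t).flip = t := by
  funext j
  have : ∀ a : ZMod 2, (if a = 0 then Pauli1.I else Pauli1.X).flip = a :=
    Pauli1.forall_bit rfl rfl
  exact this (t j)

/-- A `±1`-valued character of the Pauli group is identically `1` or has average `0`. -/
lemma one_sub_sgn_le (g : Pauli n → ℝ) (hg : ∀ Q, g Q = 1 ∨ g Q = -1)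
    (hmul : ∀ Q R, g (mul Q R) = g Q * g R) (Q₀ : Pauli n) :
    1 - g Q₀ ≤ 2 * (1 - ((2 : ℝ) ^ n * 2 ^ n)⁻¹ * ∑ Q, g Q) := by
  have hcard : (Fintype.card (Pauli n) : ℝ) = 2 ^ n * 2 ^ n := by
    have : Fintype.card Pauli1 = 4 := rfl
    rw [Fintype.card_fun, this, Fintype.card_fin]
    push_cast
    rw [← mul_pow]; norm_num
  rcases hg Q₀ with h | h
  · have hsum : ∑ Q, g Q ≤ 2 ^ n * 2 ^ n := by
      rw [← hcard]
      have : ∑ Q, g Q ≤ ∑ _Q : Pauli n, (1 : ℝ) :=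
        Finset.sum_le_sum fun Q _ => by rcases hg Q with h | h <;> rw [h]; norm_num
      simpa using this
    have : ((2 : ℝ) ^ n * 2 ^ n)⁻¹ * ∑ Q, g Q ≤ 1 := by
      rw [inv_mul_le_iff₀ (by positivity)]; linarith
    rw [h]; linarith
  -- Translation by an element where the character is -1 permutes the Pauli operators and flips the
  -- sign of the sum; the bound is then the equality 2 = 2.
  · have hsum : ∑ Q, g Q = -∑ Q, g Q := by
      conv_lhs => rw [← Equiv.sum_comp (mulEquiv Q₀)]
      rw [← Finset.sum_neg_distrib]
      refine Finset.sum_congr rfl fun Q _ => ?_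
      change g (mul Q Q₀) = _
      rw [hmul, h]; ring
    have h0 : ∑ Q, g Q = 0 := by linarith
    rw [h, h0]; norm_num

end Pauli

/-! ### The experiment in terms of the logical channels -/

section Kronecker

variable {ι κ : Type*}

lemma proj_kronecker_proj [DecidableEq ι] [DecidableEq κ] (x : ι) (y : κ) :
    proj x ⊗ₖ proj y = proj (x, y) := by
  simp only [proj, Matrix.single_kronecker_single, mul_one]

variable [Fintype ι] [Fintype κ]

lemma conjBy_kronecker (A ρ : Matrix ι ι ℂ) (B τ : Matrix κ κ ℂ) :
    conjBy (A ⊗ₖ B) (ρ ⊗ₖ τ) = conjBy A ρ ⊗ₖ conjBy B τ := by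
  simp only [conjBy_apply, Matrix.conjTranspose_kronecker, Matrix.mul_kronecker_mul]

lemma conjBy_one [DecidableEq ι] (ρ : Matrix ι ι ℂ) : conjBy (1 : Matrix ι ι ℂ) ρ = ρ := by
  simp [conjBy_apply]

lemma conjBy_proj_proj [DecidableEq ι] (x y : ι) :
    conjBy (proj x) (proj y) = if y = x then (proj x : Matrix ι ι ℂ) else 0 := by
  have h : (proj x : Matrix ι ι ℂ)ᴴ = proj x := by simp [proj]
  rw [conjBy_apply, h]
  split_ifs with hxy
  · subst hxy; simp [proj]
  · simp [proj, Matrix.single_mul_single_of_ne, Ne.symm hxy]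

lemma trace_proj [DecidableEq ι] (x : ι) : (proj x : Matrix ι ι ℂ).trace = 1 := by
  simp [proj]

lemma mixture_apply {α : Type*} [Fintype α] (op : α → Matrix ι ι ℂ) (μ : α → ℝ)
    (ρ : Matrix ι ι ℂ) : mixture op μ ρ = ∑ i, (μ i : ℂ) • conjBy (op i) ρ := by
  simp [mixture]

end Kronecker

lemma adjoin_kronecker {k s a o : ℕ} (a₀ : Bits a) (ρ : Matrix (Bits k) (Bits k) ℂ)
    (τ : Matrix (Bits s) (Bits s) ℂ) :
    adjoin (o := o) a₀ (ρ ⊗ₖ τ) = ρ ⊗ₖ (τ ⊗ₖ (proj a₀ ⊗ₖ proj 0)) := by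
  ext x y
  simp [adjoin, Matrix.kroneckerMap_apply, mul_assoc]

lemma discard_kronecker {k s a o : ℕ} (ρ : Matrix (Bits k) (Bits k) ℂ)
    (τ : Matrix (Bits s) (Bits s) ℂ) (α : Matrix (Bits a) (Bits a) ℂ)
    (ω : Matrix (Bits o) (Bits o) ℂ) :
    discard (ρ ⊗ₖ (τ ⊗ₖ (α ⊗ₖ ω))) = (α.trace * ω.trace) • (ρ ⊗ₖ τ) := by
  ext x y
  simp only [discard, LinearMap.coe_mk, AddHom.coe_mk, Matrix.of_apply,
    Matrix.kroneckerMap_apply, Matrix.smul_apply, smul_eq_mul, Matrix.trace, Matrix.diag_apply]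
  rw [Finset.sum_mul_sum, Finset.sum_mul]
  refine Finset.sum_congr rfl fun u _ => ?_
  rw [Finset.sum_mul]
  exact Finset.sum_congr rfl fun θ _ => by ring

/-! ### The cycle and the preparation on block-diagonal states. -/

namespace Cycle

variable {k s : ℕ} (c : Cycle k s)

/-- The joint probability of the randomizing bitstring `r`, the error `P` and the transition
from `sIn` to `sOut`. -/
noncomputable def weight (sOut sIn r : Bits s) (P : Pauli k × Pauli s × Pauli c.a × Pauli c.o) :
    ℝ :=
  if c.outSyndrome sIn r P = sOut then c.shiftProb r * c.noise P else 0

lemma γ_eq (sOut sIn : Bits s) : c.γ sOut sIn = ∑ r, ∑ P, c.weight sOut sIn r P := rfl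

lemma shiftProb_nonneg (r : Bits s) : 0 ≤ c.shiftProb r := by
  unfold shiftProb; split_ifs <;> positivity

lemma sum_shiftProb : ∑ r, c.shiftProb r = 1 := by
  unfold shiftProb
  split_ifs with h
  · simp [ZMod.card]
  · simp

lemma weight_nonneg (sOut sIn r : Bits s) (P : Pauli k × Pauli s × Pauli c.a × Pauli c.o) :
    0 ≤ c.weight sOut sIn r P := by
  unfold weight
  split_ifs
  · exact mul_nonneg (c.shiftProb_nonneg r) (c.noise_mem.1 P)
  · exact le_rfl

lemma γ_nonneg (sOut sIn : Bits s) : 0 ≤ c.γ sOut sIn :=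
  Finset.sum_nonneg fun r _ => Finset.sum_nonneg fun P _ => c.weight_nonneg sOut sIn r P

lemma sum_γ (sIn : Bits s) : ∑ t, c.γ t sIn = 1 := by
  simp only [γ_eq]
  rw [Finset.sum_comm]
  have h : ∀ r, ∑ t, ∑ P, c.weight t sIn r P = c.shiftProb r := by
    intro r
    rw [Finset.sum_comm]
    simp only [weight, Finset.sum_ite_eq, Finset.mem_univ, if_true]
    rw [← Finset.mul_sum, c.noise_mem.2, mul_one]
  simp only [h, sum_shiftProb]

/-- The unnormalized logical channel `γ_{s_out, s_in} Λ_{s_out, s_in}`. -/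
lemma γ_smul_Λ (sOut sIn : Bits s) :
    (c.γ sOut sIn : ℂ) • c.Λ sOut sIn = ∑ r, ∑ P, (c.weight sOut sIn r P : ℂ) •
      (conjBy (c.cor (c.errSyndrome sIn r P + r)).mat ∘ₗ conjBy P.1.mat) := by
  -- The conditional channel is defined by a division; when the divisor vanishes, so does every
  -- nonnegative weight in the sum, and both sides are 0.
  by_cases h : c.γ sOut sIn = 0
  · have hw : ∀ r P, c.weight sOut sIn r P = 0 := by
      intro r P
      rw [γ_eq] at h
      have h1 := (Finset.sum_eq_zero_iff_of_nonneg (fun r _ =>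
        Finset.sum_nonneg fun P _ => c.weight_nonneg sOut sIn r P)).1 h r (Finset.mem_univ _)
      exact (Finset.sum_eq_zero_iff_of_nonneg (fun P _ =>
        c.weight_nonneg sOut sIn r P)).1 h1 P (Finset.mem_univ _)
    simp [h, hw]
  · rw [Λ, smul_smul, mul_inv_cancel₀ (by exact_mod_cast h), one_smul]
    rfl

/-- The cycle maps block-diagonal states to block-diagonal states. -/
lemma channel_kronecker_proj (sIn : Bits s) (ρ : Matrix (Bits k) (Bits k) ℂ) :
    c.channel (ρ ⊗ₖ proj sIn) = ∑ t, ((c.γ t sIn : ℂ) • c.Λ t sIn) ρ ⊗ₖ proj t := by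
  have hread : ∀ r, conjBy ((1 : Matrix (Bits k) (Bits k) ℂ) ⊗ₖ c.C) (adjoin c.a₀
      (conjBy ((1 : Matrix (Bits k) (Bits k) ℂ) ⊗ₖ (xPauli r).mat) (ρ ⊗ₖ proj sIn))) =
      ρ ⊗ₖ (proj (sIn + r) ⊗ₖ (proj (c.b (sIn + r)) ⊗ₖ proj (c.E (sIn + r)))) := by
    intro r
    rw [conjBy_kronecker, conjBy_one, Pauli.conjBy_proj, Pauli.flip_xPauli, adjoin_kronecker,
      conjBy_kronecker, conjBy_one, proj_kronecker_proj, proj_kronecker_proj, c.readout,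
      proj_kronecker_proj, proj_kronecker_proj]
  have hbranch : ∀ r θ, ∀ P : Pauli k × Pauli s × Pauli c.a × Pauli c.o,
      discard (conjBy (c.feedback r θ) (conjBy (pauli4 P)
        (ρ ⊗ₖ (proj (sIn + r) ⊗ₖ (proj (c.b (sIn + r)) ⊗ₖ proj (c.E (sIn + r))))))) =
      if c.E (sIn + r) + P.2.2.2.flip = θ then
        conjBy (c.cor (c.errSyndrome sIn r P + r)).mat (conjBy P.1.mat ρ) ⊗ₖ
          proj (c.outSyndrome sIn r P) else 0 := by
    intro r θ P
    rw [pauli4, pauli3, pauli2, feedback]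
    simp only [conjBy_kronecker, Pauli.conjBy_proj, conjBy_one, Pauli.flip_xPauli,
      conjBy_proj_proj]
    split_ifs with h
    · subst h
      rw [discard_kronecker, trace_proj, trace_proj]
      simp [errSyndrome, outSyndrome, add_assoc]
    · simp
  simp only [γ_smul_Λ]
  simp only [channel, LinearMap.sum_apply, LinearMap.smul_apply, LinearMap.comp_apply, hread,
    mixture_apply, map_sum, map_smul, hbranch]
  -- For fixed r and P the content of the outcome register is deterministic, so a single θ
  -- contributes; likewise a single output syndrome survives below.
  have hθ : ∀ r, ∑ θ : Bits c.o, ∑ P, (c.noise P : ℂ) •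
      (if c.E (sIn + r) + P.2.2.2.flip = θ then
        conjBy (c.cor (c.errSyndrome sIn r P + r)).mat (conjBy P.1.mat ρ) ⊗ₖ
          proj (c.outSyndrome sIn r P) else 0) =
      ∑ P, (c.noise P : ℂ) • (conjBy (c.cor (c.errSyndrome sIn r P + r)).mat
        (conjBy P.1.mat ρ) ⊗ₖ proj (c.outSyndrome sIn r P)) := by
    intro r
    rw [Finset.sum_comm]
    refine Finset.sum_congr rfl fun P _ => ?_
    rw [← Finset.smul_sum]
    simp
  simp only [hθ]
  have hkron : ∀ t, (∑ r, ∑ P, (c.weight t sIn r P : ℂ) •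
      conjBy (c.cor (c.errSyndrome sIn r P + r)).mat (conjBy P.1.mat ρ)) ⊗ₖ proj t =
      ∑ r, ∑ P, (c.weight t sIn r P : ℂ) •
        (conjBy (c.cor (c.errSyndrome sIn r P + r)).mat (conjBy P.1.mat ρ) ⊗ₖ proj t) := by
    intro t
    ext x y
    simp [Matrix.sum_apply, Matrix.kroneckerMap_apply, Finset.sum_mul, mul_assoc]
  simp only [hkron]
  rw [Finset.sum_comm]
  refine Finset.sum_congr rfl fun r _ => ?_
  rw [Finset.sum_comm, Finset.smul_sum]
  refine Finset.sum_congr rfl fun P _ => ?_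
  rw [Finset.sum_eq_single (c.outSyndrome sIn r P)]
  · rw [weight, if_pos rfl, smul_smul, Complex.ofReal_mul]
  · intro t _ ht
    simp [weight, ht.symm]
  · simp

end Cycle

namespace Preparation

variable {k s : ℕ} (p : Preparation k s)

/-- The joint probability of the error `P` and the syndrome `t`. -/
noncomputable def weight (sStar t : Bits s) (P : Pauli k × Pauli s) : ℝ :=
  if sStar + P.2.flip = t then p.noise P else 0

lemma γ_eq (sStar t : Bits s) : p.γ sStar t = ∑ P, p.weight sStar t P := rfl

lemma weight_nonneg (sStar t : Bits s) (P : Pauli k × Pauli s) : 0 ≤ p.weight sStar t P := by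
  unfold weight
  split_ifs
  · exact p.noise_mem.1 P
  · exact le_rfl

lemma γ_smul_Λ (sStar t : Bits s) :
    (p.γ sStar t : ℂ) • p.Λ sStar t = ∑ P, (p.weight sStar t P : ℂ) • conjBy P.1.mat := by
  by_cases h : p.γ sStar t = 0
  · have hw : ∀ P, p.weight sStar t P = 0 := fun P =>
      (Finset.sum_eq_zero_iff_of_nonneg (fun P _ => p.weight_nonneg sStar t P)).1 h P
        (Finset.mem_univ _)
    simp [h, hw]
  · rw [Λ, smul_smul, mul_inv_cancel₀ (by exact_mod_cast h), one_smul]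
    rfl

lemma state_eq (sStar : Bits s) :
    p.state sStar = ∑ t, ((p.γ sStar t : ℂ) • p.Λ sStar t) p.σ ⊗ₖ proj t := by
  simp only [γ_smul_Λ]
  simp only [state, mixture_apply, pauli2, conjBy_kronecker, Pauli.conjBy_proj,
    LinearMap.sum_apply, LinearMap.smul_apply]
  have hkron : ∀ t, (∑ P, (p.weight sStar t P : ℂ) • conjBy P.1.mat p.σ) ⊗ₖ proj t =
      ∑ P, (p.weight sStar t P : ℂ) • (conjBy P.1.mat p.σ ⊗ₖ proj t) := by
    intro t
    ext x y
    simp [Matrix.sum_apply, Matrix.kroneckerMap_apply, Finset.sum_mul, mul_assoc]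
  simp only [hkron]
  rw [Finset.sum_comm]
  refine Finset.sum_congr rfl fun P _ => ?_
  rw [Finset.sum_eq_single (sStar + P.2.flip)]
  · simp [weight]
  · intro t _ ht
    simp [weight, ht.symm]
  · simp

end Preparation

section Experiment

variable {k s : ℕ} (c : Cycle k s) (p : Preparation k s) (m : Measurement k s)

lemma pathSum_succ_apply (K : ℕ) (t : Bits s) (ρ : Matrix (Bits k) (Bits k) ℂ) :
    pathSum c p (K + 1) t ρ = ∑ t', ((c.γ t t' : ℂ) • c.Λ t t') (pathSum c p K t' ρ) := by
  simp [pathSum]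

/-- The state of `L` and `S` after `K` cycles. -/
lemma channel_pow_state (K : ℕ) :
    (c.channel ^ K) (p.state c.sStar) = ∑ t, pathSum c p K t p.σ ⊗ₖ proj t := by
  induction K with
  | zero => simp only [pow_zero, Module.End.one_apply, p.state_eq, pathSum]
  | succ K ih =>
    rw [pow_succ', Module.End.mul_apply, ih, map_sum]
    simp only [c.channel_kronecker_proj, pathSum_succ_apply]
    rw [Finset.sum_comm]
    refine Finset.sum_congr rfl fun t _ => ?_
    ext x y
    simp only [Matrix.sum_apply, Matrix.kroneckerMap_apply, Finset.sum_mul]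

lemma isHermitian_sum_smul {ι n : Type*} [Fintype ι] (w : ι → ℝ) (A : ι → Matrix n n ℂ)
    (hA : ∀ i, (A i).IsHermitian) : (∑ i, (w i : ℂ) • A i).IsHermitian := by
  simp only [Matrix.IsHermitian, Matrix.conjTranspose_sum, Matrix.conjTranspose_smul,
    (hA _).eq, RCLike.star_def, Complex.conj_ofReal]

lemma isHermitian_conjBy {m n : Type*} [Fintype m] [Fintype n] (K : Matrix m n ℂ)
    {ρ : Matrix n n ℂ} (hρ : ρ.IsHermitian) : (conjBy K ρ).IsHermitian :=
  Matrix.isHermitian_mul_mul_conjTranspose K hρ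

/-- Measurement probabilities are defined through a real part; Hermiticity of the blocks shows that
nothing is lost by taking it. -/
lemma isHermitian_pathSum (K : ℕ) (t : Bits s) : (pathSum c p K t p.σ).IsHermitian := by
  induction K generalizing t with
  | zero =>
    simp only [pathSum, p.γ_smul_Λ, LinearMap.sum_apply, LinearMap.smul_apply]
    exact isHermitian_sum_smul _ _ fun P => isHermitian_conjBy _ p.posSemidef.isHermitian
  | succ K ih =>
    simp only [pathSum_succ_apply, c.γ_smul_Λ, LinearMap.sum_apply, LinearMap.smul_apply,
      LinearMap.comp_apply, ← Fintype.sum_prod_type']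
    exact isHermitian_sum_smul _ _ fun i => isHermitian_conjBy _ (isHermitian_conjBy _ (ih _))

lemma conjBy_single {ι κ : Type*} [Fintype ι] [Fintype κ] [DecidableEq ι]
    (U : Matrix κ ι ℂ) (i j : ι) :
    conjBy U (Matrix.single i j 1) =
      Matrix.vecMulVec (U *ᵥ Pi.single i 1) (star (U *ᵥ Pi.single j 1)) := by
  ext x y
  simp [conjBy_apply, Matrix.mul_apply, Matrix.single_apply, Matrix.vecMulVec_apply, ite_and]

lemma conjBy_mul {ι κ τ : Type*} [Fintype ι] [Fintype κ] [Fintype τ]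
    (U : Matrix τ κ ℂ) (W : Matrix κ ι ℂ) (ρ : Matrix ι ι ℂ) :
    conjBy U (conjBy W ρ) = conjBy (U * W) ρ := by
  simp only [conjBy_apply, Matrix.conjTranspose_mul, Matrix.mul_assoc]

/-! ### Outcome statistics of a noisy measurement. -/

namespace Measurement

lemma conjTranspose_V_mul : m.Vᴴ * m.V = 1 := Matrix.mem_unitaryGroup_iff'.1 m.V_clifford.1

lemma V_mul_conjTranspose : m.V * m.Vᴴ = 1 := Matrix.mem_unitaryGroup_iff.1 m.V_clifford.1

/-- In the basis V†|x⟩ the operator A has the entries of V A V†, and the readout is specified on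
vectors rather than projectors, so it fixes the image of the off-diagonal terms as well. -/
lemma conjBy_C_adjoin (A : Matrix (Bits k) (Bits k) ℂ) (t : Bits s) :
    conjBy m.C (adjoin m.a₀ (A ⊗ₖ proj t)) =
      ∑ x, ∑ y, (conjBy m.V A) x y •
        Matrix.single (x, t, m.b x t, m.E x t) (y, t, m.b y t, m.E y t) (1 : ℂ) := by
  have hA : A = conjBy m.Vᴴ (conjBy m.V A) := by
    rw [conjBy_mul, m.conjTranspose_V_mul, conjBy_one]
  have hτ : proj t ⊗ₖ (proj m.a₀ ⊗ₖ proj (0 : Bits m.o)) =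
      conjBy 1 (proj (t, m.a₀, (0 : Bits m.o))) := by
    rw [conjBy_one, proj_kronecker_proj, proj_kronecker_proj]
  rw [adjoin_kronecker]
  conv_lhs => rw [hA]
  rw [hτ, ← conjBy_kronecker, conjBy_mul]
  generalize conjBy m.V A = B
  have hB : B ⊗ₖ proj (t, m.a₀, (0 : Bits m.o)) = ∑ x, ∑ y, B x y •
      Matrix.single (x, t, m.a₀, (0 : Bits m.o)) (y, t, m.a₀, (0 : Bits m.o)) (1 : ℂ) := by
    conv_lhs => rw [Matrix.matrix_eq_sum_single B]
    have h1 : ∀ x y, B x y • Matrix.single (x, t, m.a₀, (0 : Bits m.o))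
        (y, t, m.a₀, (0 : Bits m.o)) (1 : ℂ) =
        Matrix.single x y (B x y) ⊗ₖ proj (t, m.a₀, (0 : Bits m.o)) := by
      intro x y
      rw [proj, Matrix.single_kronecker_single, Matrix.smul_single, smul_eq_mul]
    simp only [h1]
    ext x y
    simp only [Matrix.sum_apply, Matrix.kroneckerMap_apply, Finset.sum_mul]
  rw [hB]
  simp only [map_sum, map_smul, conjBy_single, m.readout]
  refine Finset.sum_congr rfl fun x _ => Finset.sum_congr rfl fun y _ => ?_
  congr 1
  generalize (x, t, m.b x t, m.E x t) = i
  generalize (y, t, m.b y t, m.E y t) = j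
  ext i' j'
  simp only [Matrix.vecMulVec_apply, Pi.single_apply, Pi.star_apply, Matrix.single_apply,
    apply_ite star, star_one, star_zero, ite_and, mul_ite, mul_one, mul_zero,
    @eq_comm _ i', @eq_comm _ j']
  split_ifs <;> rfl

lemma trace_conjBy_mat_single {n : ℕ} (P : Pauli n) (x y : Bits n) :
    (conjBy P.mat (Matrix.single x y 1)).trace = if x = y then 1 else 0 := by
  rw [conjBy_apply, Matrix.trace_mul_cycle, Pauli.conjTranspose_mat, Pauli.mat_mul_self,
    Matrix.one_mul]
  split_ifs with h
  · rw [h, Matrix.trace_single_eq_same]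
  · exact Matrix.trace_single_eq_of_ne _ _ _ h

/-- The trace factorizes over the registers, and the trace over `L` removes coherences between
different x, even after a Pauli error; only the flip on `O` affects the outcome. -/
lemma trace_outcome (P : Pauli k × Pauli s × Pauli m.a × Pauli m.o) (θ : Bits m.o)
    (x y : Bits k) (t : Bits s) :
    (((1 : Matrix (Bits k) (Bits k) ℂ) ⊗ₖ ((1 : Matrix (Bits s) (Bits s) ℂ) ⊗ₖ
      ((1 : Matrix (Bits m.a) (Bits m.a) ℂ) ⊗ₖ proj θ))) *
      conjBy (pauli4 P) (Matrix.single (x, t, m.b x t, m.E x t)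
        (y, t, m.b y t, m.E y t) 1)).trace =
    if x = y then (if m.E y t + P.2.2.2.flip = θ then 1 else 0) else 0 := by
  have hs : Matrix.single (x, t, m.b x t, m.E x t) (y, t, m.b y t, m.E y t) (1 : ℂ) =
      Matrix.single x y 1 ⊗ₖ (Matrix.single t t 1 ⊗ₖ
        (Matrix.single (m.b x t) (m.b y t) 1 ⊗ₖ Matrix.single (m.E x t) (m.E y t) 1)) := by
    simp only [Matrix.single_kronecker_single, mul_one]
  rw [hs, pauli4, pauli3, pauli2]
  simp only [conjBy_kronecker, ← Matrix.mul_kronecker_mul, Matrix.trace_kronecker,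
    Matrix.one_mul, trace_conjBy_mat_single, if_true]
  by_cases hxy : x = y
  · subst hxy
    have hE : conjBy P.2.2.2.mat (Matrix.single (m.E x t) (m.E x t) 1) =
      proj (m.E x t + P.2.2.2.flip) := Pauli.conjBy_proj _ _
    rw [hE]
    by_cases h : m.E x t + P.2.2.2.flip = θ
    · simp [h, proj]
    · simp [h, proj, Matrix.single_mul_single_of_ne, Ne.symm h]
  · simp [hxy]

lemma trace_readout (A : Matrix (Bits k) (Bits k) ℂ) (t : Bits s) (θ : Bits m.o) :
    (((1 : Matrix (Bits k) (Bits k) ℂ) ⊗ₖ ((1 : Matrix (Bits s) (Bits s) ℂ) ⊗ₖ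
      ((1 : Matrix (Bits m.a) (Bits m.a) ℂ) ⊗ₖ proj θ))) *
      mixture pauli4 m.noise (conjBy m.C (adjoin m.a₀ (A ⊗ₖ proj t)))).trace =
    ∑ y, ∑ P, (if m.E y t + P.2.2.2.flip = θ then (m.noise P : ℂ) else 0) *
      (conjBy m.V A) y y := by
  rw [conjBy_C_adjoin, mixture_apply]
  simp only [map_sum, map_smul, Matrix.trace_sum, Matrix.mul_smul,
    Matrix.trace_smul, trace_outcome, smul_eq_mul, Finset.mul_sum]
  rw [Finset.sum_comm]
  refine Finset.sum_congr rfl fun x _ => ?_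
  refine Finset.sum_congr rfl fun P _ => ?_
  rw [Finset.sum_eq_single x]
  · split_ifs <;> simp_all
  · intro y _ hy; simp [hy.symm]
  · simp

/-- The effect whose expectation is the probability of the outcome `x` for the syndrome `t`. -/
noncomputable def effect (t : Bits s) (x : Bits k) : Matrix (Bits k) (Bits k) ℂ :=
  m.Vᴴ * Matrix.diagonal (fun y => (m.kernel t x y : ℂ)) * m.V

lemma trace_effect_mul (t : Bits s) (x : Bits k) (A : Matrix (Bits k) (Bits k) ℂ) :
    (m.effect t x * A).trace = ∑ y, (m.kernel t x y : ℂ) * (conjBy m.V A) y y := by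
  rw [effect, Matrix.mul_assoc, Matrix.mul_assoc, Matrix.trace_mul_comm, Matrix.mul_assoc,
    ← conjBy_apply]
  simp [Matrix.trace, Matrix.diagonal_mul]

/-- Heisenberg picture: the term V†|x'⟩⟨y|V of the channel transfers the diagonal entry y of V A V†
to position x', and the POVM element keeps x' = x. -/
lemma trace_povm_mul_Λ (t : Bits s) (x : Bits k) (A : Matrix (Bits k) (Bits k) ℂ) :
    (m.povm x * m.Λ t A).trace = (m.effect t x * A).trace := by
  have h1 : ∀ x' y, (m.povm x * conjBy (m.Vᴴ * Matrix.single x' y 1 * m.V) A).trace =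
      if x' = x then (conjBy m.V A) y y else 0 := by
    intro x' y
    have h2 : m.povm x * conjBy (m.Vᴴ * Matrix.single x' y 1 * m.V) A =
        m.Vᴴ * (proj x * ((m.V * m.Vᴴ) * (Matrix.single x' y 1 * (conjBy m.V A) *
          Matrix.single y x' 1))) * m.V := by
      simp [povm, conjBy_apply, Matrix.mul_assoc]
    rw [h2, Matrix.trace_mul_cycle, V_mul_conjTranspose, Matrix.one_mul, Matrix.one_mul]
    generalize conjBy m.V A = B
    split_ifs with h
    · subst h
      simp [proj]
    · rw [Matrix.mul_assoc, ← Matrix.mul_assoc (proj x)]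
      simp [proj, Matrix.single_mul_single_of_ne, Ne.symm h]
  rw [trace_effect_mul]
  simp only [Λ, LinearMap.sum_apply, LinearMap.smul_apply, Matrix.mul_sum, Matrix.trace_sum,
    Matrix.mul_smul, Matrix.trace_smul, h1, smul_eq_mul]
  rw [Finset.sum_comm]
  simp

lemma prob_sum_kronecker_proj (A : Bits s → Matrix (Bits k) (Bits k) ℂ)
    (hA : ∀ t, (A t).IsHermitian) (x : Bits k) :
    (m.prob (∑ t, A t ⊗ₖ proj t) x : ℂ) = ∑ t, (m.povm x * m.Λ t (A t)).trace := by
  have hre : ∀ t y, (((conjBy m.V (A t)) y y).re : ℂ) = (conjBy m.V (A t)) y y := by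
    intro t y
    rw [← Complex.conj_eq_iff_re]
    exact (isHermitian_conjBy m.V (hA t)).apply y y
  simp only [trace_povm_mul_Λ, trace_effect_mul, prob, map_sum, Matrix.mul_sum,
    Matrix.trace_sum, trace_readout]
  have hre' : ∀ θ, (∑ t, ∑ y, ∑ P : Pauli k × Pauli s × Pauli m.a × Pauli m.o,
      (if m.E y t + P.2.2.2.flip = θ then (m.noise P : ℂ) else 0) * (conjBy m.V (A t)) y y).re =
      ∑ t, ∑ y, ∑ P : Pauli k × Pauli s × Pauli m.a × Pauli m.o,
        (if m.E y t + P.2.2.2.flip = θ then m.noise P else 0) * ((conjBy m.V (A t)) y y).re := by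
    intro θ
    simp only [Complex.re_sum]
    refine Finset.sum_congr rfl fun t _ => Finset.sum_congr rfl fun y _ =>
      Finset.sum_congr rfl fun P _ => ?_
    split_ifs <;> simp
  simp only [hre']
  have hre'' : ∀ t y, (m.kernel t x y : ℂ) * (conjBy m.V (A t)) y y =
      ((m.kernel t x y * ((conjBy m.V (A t)) y y).re : ℝ) : ℂ) := by
    intro t y; rw [← hre t y]; push_cast; simp
  simp only [hre'', ← Complex.ofReal_sum]
  congr 1
  -- Moving the decoding condition inside lets the sum over θ collapse, for each y, t and P, to the
  -- decoded value that enters the kernel.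
  have h3 : ∀ θ, (if m.D θ = x then ∑ t, ∑ y, ∑ P : Pauli k × Pauli s × Pauli m.a × Pauli m.o,
        (if m.E y t + P.2.2.2.flip = θ then m.noise P else 0) * ((conjBy m.V (A t)) y y).re
        else 0) =
      ∑ t, ∑ y, ∑ P : Pauli k × Pauli s × Pauli m.a × Pauli m.o,
        if m.E y t + P.2.2.2.flip = θ then
          (if m.D θ = x then m.noise P else 0) * ((conjBy m.V (A t)) y y).re else 0 := by
    intro θ
    split_ifs with h
    · simp only [ite_mul, zero_mul]
    · simp
  simp only [h3]
  rw [Finset.sum_comm]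
  refine Finset.sum_congr rfl fun t _ => ?_
  rw [Finset.sum_comm]
  refine Finset.sum_congr rfl fun y _ => ?_
  rw [Finset.sum_comm, kernel, Finset.sum_mul]
  refine Finset.sum_congr rfl fun P _ => ?_
  simp

end Measurement

/-- The outcome probabilities are determined by the total logical error channel. -/
theorem experimentProb_eq (K : ℕ) (x : Bits k) :
    (experimentProb c p m K x : ℂ) = (m.povm x * Λtot c p m K p.σ).trace := by
  rw [experimentProb, channel_pow_state,
    m.prob_sum_kronecker_proj _ (isHermitian_pathSum c p K)]
  simp [Λtot, Matrix.mul_sum, Matrix.trace_sum]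

end Experiment

/-! ### Eigenvalues of the logical Pauli channels -/

/-- A weighted average of signs. Zero total weight is included, since the inverse is then 0; this
covers syndromes of probability zero. -/
lemma abs_inv_mul_sum_le_one {ι : Type*} [Fintype ι] (w g : ι → ℝ) (hw : ∀ i, 0 ≤ w i)
    (hg : ∀ i, |g i| = 1) : |(∑ i, w i)⁻¹ * ∑ i, w i * g i| ≤ 1 := by
  have h0 : 0 ≤ ∑ i, w i := Finset.sum_nonneg fun i _ => hw i
  have h1 : |∑ i, w i * g i| ≤ ∑ i, w i := by
    refine (Finset.abs_sum_le_sum_abs _ _).trans (Finset.sum_le_sum fun i _ => ?_)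
    rw [abs_mul, hg, mul_one, abs_of_nonneg (hw i)]
  rw [abs_mul, abs_inv, abs_of_nonneg h0]
  exact inv_mul_le_one_of_le₀ h1 h0

lemma Pauli.abs_sgn {n : ℕ} (A Q : Pauli n) : |A.sgn Q| = 1 := by
  rcases A.sgn_eq Q with h | h <;> simp [h]

namespace Preparation

variable {k s : ℕ} (p : Preparation k s)

/-- The eigenvalue of the conditional logical channel of a preparation at a Pauli operator. -/
noncomputable def eigenvalue (sStar t : Bits s) (Q : Pauli k) : ℝ :=
  (p.γ sStar t)⁻¹ * ∑ P, p.weight sStar t P * P.1.sgn Q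

lemma Λ_mat (sStar t : Bits s) (Q : Pauli k) :
    p.Λ sStar t Q.mat = (p.eigenvalue sStar t Q : ℂ) • Q.mat := by
  simp only [Λ, LinearMap.smul_apply, LinearMap.sum_apply, Pauli.conjBy_mat, smul_smul,
    ← Finset.sum_smul, eigenvalue, weight]
  push_cast
  rfl

lemma abs_eigenvalue_le (sStar t : Bits s) (Q : Pauli k) : |p.eigenvalue sStar t Q| ≤ 1 :=
  abs_inv_mul_sum_le_one _ _ (p.weight_nonneg sStar t) fun P => P.1.abs_sgn Q

end Preparation

namespace Cycle

variable {k s : ℕ} (c : Cycle k s)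

/-- The eigenvalue of `Λ_{s_out, s_in}` at a Pauli operator. -/
noncomputable def eigenvalue (t t' : Bits s) (Q : Pauli k) : ℝ :=
  (c.γ t t')⁻¹ * ∑ r, ∑ P, c.weight t t' r P *
    ((c.cor (c.errSyndrome t' r P + r)).sgn Q * P.1.sgn Q)

lemma Λ_mat (t t' : Bits s) (Q : Pauli k) :
    c.Λ t t' Q.mat = (c.eigenvalue t t' Q : ℂ) • Q.mat := by
  simp only [Λ, LinearMap.smul_apply, LinearMap.sum_apply, LinearMap.comp_apply,
    Pauli.conjBy_mat, map_smul, smul_smul, ← Finset.sum_smul, eigenvalue, weight]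
  push_cast
  congr 2
  refine Finset.sum_congr rfl fun r _ => Finset.sum_congr rfl fun P _ => ?_
  ring

lemma abs_eigenvalue_le (t t' : Bits s) (Q : Pauli k) : |c.eigenvalue t t' Q| ≤ 1 := by
  unfold eigenvalue
  simp only [γ_eq, ← Fintype.sum_prod_type']
  exact abs_inv_mul_sum_le_one _ _ (fun i => c.weight_nonneg t t' i.1 i.2) fun i => by
    rw [abs_mul, Pauli.abs_sgn, Pauli.abs_sgn, one_mul]

lemma marginal_nonneg (t : Bits s) : 0 ≤ c.marginal t := c.γ_nonneg _ _

lemma sum_marginal : ∑ t, c.marginal t = 1 := c.sum_γ _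

/-- The sign of the correction for the true syndrome `t` at a Pauli operator. -/
noncomputable def corSgn (t : Bits s) (Q : Pauli k) : ℝ := (c.cor (t + c.sStar)).sgn Q

/-- The eigenvalue of the single-cycle logical error channel at a Pauli operator. -/
noncomputable def eigenvalue₁ (Q : Pauli k) : ℝ :=
  ∑ t, ∑ t', c.marginal t * c.marginal t' *
    (c.corSgn t Q * c.corSgn t' Q * c.eigenvalue t t' Q)

lemma Λ₁_mat (Q : Pauli k) : c.Λ₁ Q.mat = (c.eigenvalue₁ Q : ℂ) • Q.mat := by
  simp only [Λ₁, Λtilde, corMat, LinearMap.smul_apply, LinearMap.sum_apply,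
    LinearMap.comp_apply, Pauli.conjTranspose_mat,
    Pauli.conjBy_mat, map_smul, Λ_mat, smul_smul, ← Finset.sum_smul, eigenvalue₁, corSgn]
  push_cast
  congr 1
  refine Finset.sum_congr rfl fun r _ => Finset.sum_congr rfl fun P _ => ?_
  ring

/-- Since tr(Q²) = D, the entanglement fidelity is the plain average of the D² Pauli eigenvalues. -/
lemma f₁_eq : c.f₁ = ((2 : ℝ) ^ k * 2 ^ k)⁻¹ * ∑ Q, c.eigenvalue₁ Q := by
  have h : ∀ Q : Pauli k, (Q.mat * c.Λ₁ Q.mat).trace =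
      ((c.eigenvalue₁ Q * 2 ^ k : ℝ) : ℂ) := by
    intro Q
    rw [Λ₁_mat, Matrix.mul_smul, Matrix.trace_smul, Pauli.trace_mat_mul_mat, if_pos rfl]
    push_cast; rfl
  simp only [f₁, h]
  rw [← Complex.ofReal_sum, Complex.ofReal_re, ← Finset.sum_mul]
  field_simp

lemma marginal_eq (hc : c.SyndromeMarginalIndependence) (t t' : Bits s) :
    c.γ t t' = c.marginal t := hc _ _ _

/-- Each eigenvalue of the single-cycle error channel is controlled by the fidelity. -/
lemma one_sub_eigenvalue₁_le (hc : c.SyndromeMarginalIndependence) (Q : Pauli k) :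
    1 - c.eigenvalue₁ Q ≤ 2 * (1 - c.f₁) := by
  -- An index is a full realization: output syndrome, input syndrome, random shift and error. The
  -- eigenvalue is the `W`-average of g, and for each realization g is a character, because the
  -- commutation sign with a Pauli operator is multiplicative.
  let ι := Bits s × Bits s × Bits s × (Pauli k × Pauli s × Pauli c.a × Pauli c.o)
  let W : ι → ℝ := fun i => c.marginal i.1 * c.marginal i.2.1 *
    ((c.γ i.1 i.2.1)⁻¹ * c.weight i.1 i.2.1 i.2.2.1 i.2.2.2)
  let g : ι → Pauli k → ℝ := fun i Q => c.corSgn i.1 Q * c.corSgn i.2.1 Q *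
    ((c.cor (c.errSyndrome i.2.1 i.2.2.1 i.2.2.2 + i.2.2.1)).sgn Q * i.2.2.2.1.sgn Q)
  have hW0 : ∀ i, 0 ≤ W i := fun i =>
    mul_nonneg (mul_nonneg (c.marginal_nonneg _) (c.marginal_nonneg _))
      (mul_nonneg (inv_nonneg.2 (c.γ_nonneg _ _)) (c.weight_nonneg _ _ _ _))
  have hW1 : ∑ i, W i = 1 := by
    simp only [ι, W, Fintype.sum_prod_type (α₁ := Bits s), ← Finset.mul_sum, ← γ_eq,
      c.marginal_eq hc]
    have h : ∀ t t', c.marginal t * c.marginal t' * ((c.marginal t)⁻¹ * c.marginal t) =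
        c.marginal t * c.marginal t' := by
      intro t t'
      by_cases h0 : c.marginal t = 0
      · simp [h0]
      · rw [inv_mul_cancel₀ h0, mul_one]
    simp only [h, ← Finset.mul_sum, sum_marginal, mul_one]
  have hev : ∀ Q, c.eigenvalue₁ Q = ∑ i, W i * g i Q := by
    intro Q
    simp only [ι, W, g, Fintype.sum_prod_type (α₁ := Bits s), eigenvalue₁, eigenvalue,
      Finset.mul_sum]
    refine Finset.sum_congr rfl fun t _ => Finset.sum_congr rfl fun t' _ =>
      Finset.sum_congr rfl fun r _ => Finset.sum_congr rfl fun P _ => ?_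
    ring
  have hg : ∀ i Q, g i Q = 1 ∨ g i Q = -1 := by
    intro i Q
    rw [← mul_self_eq_one_iff]
    have h1 := Pauli.sgn_mul_self (c.cor (i.1 + c.sStar)) Q
    have h2 := Pauli.sgn_mul_self (c.cor (i.2.1 + c.sStar)) Q
    have h3 := Pauli.sgn_mul_self (c.cor (c.errSyndrome i.2.1 i.2.2.1 i.2.2.2 + i.2.2.1)) Q
    have h4 := Pauli.sgn_mul_self i.2.2.2.1 Q
    simp only [g, corSgn]
    rw [mul_mul_mul_comm, mul_mul_mul_comm (Pauli.sgn _ Q), h1, h2,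
      mul_mul_mul_comm (Pauli.sgn _ Q), h3, h4]
    norm_num
  have hgm : ∀ i Q R, g i (Pauli.mul Q R) = g i Q * g i R := by
    intro i Q R
    simp only [g, corSgn, Pauli.sgn_mul]
    ring
  have hsum : ∑ Q, c.eigenvalue₁ Q = ∑ i, W i * ∑ Q, g i Q := by
    simp only [hev, Finset.mul_sum]
    exact Finset.sum_comm
  calc 1 - c.eigenvalue₁ Q = ∑ i, W i * (1 - g i Q) := by
        simp only [mul_sub, mul_one, Finset.sum_sub_distrib, hW1, hev]
    _ ≤ ∑ i, W i * (2 * (1 - ((2 : ℝ) ^ k * 2 ^ k)⁻¹ * ∑ Q, g i Q)) :=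
        Finset.sum_le_sum fun i _ =>
          mul_le_mul_of_nonneg_left (Pauli.one_sub_sgn_le (g i) (hg i) (hgm i) Q) (hW0 i)
    _ = 2 * (∑ i, W i - ((2 : ℝ) ^ k * 2 ^ k)⁻¹ * ∑ i, W i * ∑ Q, g i Q) := by
        rw [Finset.mul_sum, ← Finset.sum_sub_distrib, Finset.mul_sum]
        exact Finset.sum_congr rfl fun i _ => by ring
    _ = 2 * (1 - c.f₁) := by rw [hW1, f₁_eq, hsum]

/-- The transfer matrix of the syndrome chain weighted with the eigenvalues at `Q`. -/
noncomputable def transfer (Q : Pauli k) :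
    EuclideanSpace ℝ (Bits s) →L[ℝ] EuclideanSpace ℝ (Bits s) :=
  Matrix.toEuclideanCLM (𝕜 := ℝ)
    (Matrix.of fun t t' => √(c.marginal t) * √(c.marginal t') * c.eigenvalue t t' Q)

lemma transfer_apply (Q : Pauli k) (x : EuclideanSpace ℝ (Bits s)) (t : Bits s) :
    c.transfer Q x t =
      ∑ t', √(c.marginal t) * √(c.marginal t') * c.eigenvalue t t' Q * x t' := by
  simp [transfer, Matrix.mulVec, dotProduct]

/-- The leading eigenvector of the transfer matrix in the absence of errors. -/
noncomputable def idealVector (Q : Pauli k) : EuclideanSpace ℝ (Bits s) :=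
  WithLp.toLp 2 fun t => √(c.marginal t) * c.corSgn t Q

lemma norm_idealVector (Q : Pauli k) : ‖c.idealVector Q‖ = 1 := by
  rw [EuclideanSpace.norm_eq, Real.sqrt_eq_one]
  simp only [idealVector, Real.norm_eq_abs, sq_abs, mul_pow,
    Real.sq_sqrt (c.marginal_nonneg _)]
  simp only [pow_two, corSgn, Pauli.sgn_mul_self, mul_one, sum_marginal]

lemma norm_transfer_sub_le (hc : c.SyndromeMarginalIndependence) {ε₁ : ℝ}
    (hf : 1 - ε₁ ≤ c.f₁) (Q : Pauli k) (x : EuclideanSpace ℝ (Bits s)) :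
    ‖c.transfer Q x - inner ℝ (c.idealVector Q) x • c.idealVector Q‖ ≤ 2 * √ε₁ * ‖x‖ := by
  set a : Bits s → Bits s → ℝ := fun t t' => √(c.marginal t) * √(c.marginal t') *
    (c.eigenvalue t t' Q - c.corSgn t Q * c.corSgn t' Q) with ha
  have hsgn : ∀ t, c.corSgn t Q * c.corSgn t Q = 1 := fun t => Pauli.sgn_mul_self _ _
  have hentry : ∀ t, (c.transfer Q x - inner ℝ (c.idealVector Q) x • c.idealVector Q) t =
      ∑ t', a t t' * x t' := by
    intro t
    simp only [PiLp.sub_apply, PiLp.smul_apply, transfer_apply, smul_eq_mul, PiLp.inner_apply,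
      idealVector, Finset.sum_mul]
    rw [← Finset.sum_sub_distrib]
    refine Finset.sum_congr rfl fun t' _ => ?_
    simp [ha]
    ring
  have hfrob : ∑ t, ∑ t', a t t' ^ 2 ≤ 4 * ε₁ := by
    calc ∑ t, ∑ t', a t t' ^ 2
        ≤ ∑ t, ∑ t', (2 * (c.marginal t * c.marginal t') - 2 * (c.marginal t * c.marginal t' *
          (c.corSgn t Q * c.corSgn t' Q * c.eigenvalue t t' Q))) := by
          refine Finset.sum_le_sum fun t _ => Finset.sum_le_sum fun t' _ => ?_
          have h1 := abs_le.1 (c.abs_eigenvalue_le t t' Q)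
          have h2 := Real.sq_sqrt (c.marginal_nonneg t)
          have h3 := Real.sq_sqrt (c.marginal_nonneg t')
          have h4 : (c.corSgn t Q * c.corSgn t' Q) ^ 2 = 1 := by
            rw [mul_pow, pow_two, pow_two, hsgn, hsgn, one_mul]
          have h5 : a t t' ^ 2 = c.marginal t * c.marginal t' *
              (c.eigenvalue t t' Q - c.corSgn t Q * c.corSgn t' Q) ^ 2 := by
            rw [ha]; simp only [mul_pow, h2, h3]
          rw [h5]
          -- Both the eigenvalue and the sign product have square at most 1, so only the cross term
          -- remains; it sums to the single-cycle eigenvalue.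
          have h6 : (c.eigenvalue t t' Q - c.corSgn t Q * c.corSgn t' Q) ^ 2 ≤
              2 - 2 * (c.corSgn t Q * c.corSgn t' Q * c.eigenvalue t t' Q) := by
            nlinarith
          have h7 := mul_le_mul_of_nonneg_left h6
            (mul_nonneg (c.marginal_nonneg t) (c.marginal_nonneg t'))
          linarith
      _ = 2 * (1 - c.eigenvalue₁ Q) := by
          simp only [Finset.sum_sub_distrib, ← Finset.mul_sum, sum_marginal, mul_one,
            eigenvalue₁]
          ring
      _ ≤ 4 * ε₁ := by linarith [c.one_sub_eigenvalue₁_le hc Q]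
  have hx : ‖x‖ ^ 2 = ∑ t, x t ^ 2 := by rw [EuclideanSpace.norm_sq_eq]; simp
  have hε : 0 ≤ ε₁ := by
    have : 0 ≤ ∑ t, ∑ t', a t t' ^ 2 :=
      Finset.sum_nonneg fun _ _ => Finset.sum_nonneg fun _ _ => sq_nonneg _
    linarith
  refine (sq_le_sq₀ (norm_nonneg _) (by positivity)).1 ?_
  rw [EuclideanSpace.norm_sq_eq, mul_pow, mul_pow, Real.sq_sqrt hε]
  simp only [hentry, Real.norm_eq_abs, sq_abs]
  -- The Frobenius norm dominates the operator norm.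
  calc ∑ t, (∑ t', a t t' * x t') ^ 2 ≤ ∑ t, (∑ t', a t t' ^ 2) * ∑ t', x t' ^ 2 :=
        Finset.sum_le_sum fun t _ => Finset.sum_mul_sq_le_sq_mul_sq _ _ _
    _ = (∑ t, ∑ t', a t t' ^ 2) * ‖x‖ ^ 2 := by rw [← Finset.sum_mul, hx]
    _ ≤ 2 ^ 2 * ε₁ * ‖x‖ ^ 2 := by
        refine mul_le_mul_of_nonneg_right ?_ (sq_nonneg _)
        linarith

end Cycle

/-! ### The logical Markovian model -/

section Model

variable {k s : ℕ} (c : Cycle k s) (p : Preparation k s) (m : Measurement k s)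

/-- The vector of eigenvalues of a preparation, weighted with the syndrome marginal. -/
noncomputable def prepVector (Q : Pauli k) : EuclideanSpace ℝ (Bits s) :=
  WithLp.toLp 2 fun t => √(c.marginal t) * p.eigenvalue c.sStar t Q

lemma norm_prepVector_le (Q : Pauli k) : ‖prepVector c p Q‖ ≤ 1 := by
  rw [EuclideanSpace.norm_eq, Real.sqrt_le_iff]
  refine ⟨zero_le_one, ?_⟩
  rw [one_pow]
  simp only [prepVector, Real.norm_eq_abs, sq_abs, mul_pow, Real.sq_sqrt (c.marginal_nonneg _)]
  rw [← c.sum_marginal]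
  refine Finset.sum_le_sum fun t _ => mul_le_of_le_one_right (c.marginal_nonneg t) ?_
  rw [sq_le_one_iff_abs_le_one]
  exact p.abs_eigenvalue_le _ _ _

/-- Conjugation by diag(√γ) turns the recursion matrix γ_t λ_{tt'} into the transfer matrix. The
start of the recursion fits because the preparation has the syndrome marginal γ of the cycle. -/
lemma pathSum_mat (hc : c.SyndromeMarginalIndependence)
    (hp : ∀ t, p.γ c.sStar t = c.marginal t) (Q : Pauli k) (K : ℕ) (t : Bits s) :
    pathSum c p K t Q.mat =
      ((√(c.marginal t) * ((c.transfer Q) ^ K) (prepVector c p Q) t : ℝ) : ℂ) • Q.mat := by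
  induction K generalizing t with
  | zero =>
    simp only [pathSum, LinearMap.smul_apply, p.Λ_mat, hp, smul_smul, ← Complex.ofReal_mul,
      pow_zero, one_apply_eq_self, prepVector]
    rw [← mul_assoc, Real.mul_self_sqrt (c.marginal_nonneg t)]
  | succ K ih =>
    simp only [pathSum_succ_apply, ih, map_smul, LinearMap.smul_apply, c.Λ_mat, smul_smul,
      ← Complex.ofReal_mul, ← Finset.sum_smul, ← Complex.ofReal_sum, c.marginal_eq hc]
    rw [pow_succ' (c.transfer Q), mul_apply_eq_comp, c.transfer_apply, Finset.mul_sum]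
    congr 2
    refine Finset.sum_congr rfl fun t' _ => ?_
    have h := Real.mul_self_sqrt (c.marginal_nonneg t)
    conv_lhs => rw [← h]
    ring

/-- The superoperator with eigenvalue `h Q` at the Pauli operator `Q`. -/
noncomputable def pauliDiagonal (h : Pauli k → ℝ) : Superop k where
  toFun A := ∑ P : Pauli k, (((2 : ℂ) ^ k)⁻¹ * (P.mat * A).trace) • (h P : ℂ) • P.mat
  map_add' A B := by
    simp only [Matrix.trace_add, mul_add, add_smul, Finset.sum_add_distrib]
  map_smul' z A := by
    simp only [Matrix.mul_smul, Matrix.trace_smul, Finset.smul_sum, smul_smul, smul_eq_mul,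
      RingHom.id_apply]
    refine Finset.sum_congr rfl fun P _ => ?_
    congr 1; ring

lemma pauliDiagonal_mat (h : Pauli k → ℝ) (Q : Pauli k) :
    pauliDiagonal h Q.mat = (h Q : ℂ) • Q.mat := by
  change ∑ P : Pauli k, (((2 : ℂ) ^ k)⁻¹ * (P.mat * Q.mat).trace) • (h P : ℂ) • P.mat = _
  rw [Finset.sum_eq_single Q]
  · rw [Pauli.trace_mat_mul_mat, if_pos rfl, inv_mul_cancel₀ (by positivity), one_smul]
  · intro P _ hP
    rw [Pauli.trace_mat_mul_mat, if_neg hP, mul_zero, zero_smul]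
  · simp

lemma pauliDiagonal_pow_mat (h : Pauli k → ℝ) (Q : Pauli k) (K : ℕ) :
    (pauliDiagonal h ^ K) Q.mat = ((h Q ^ K : ℝ) : ℂ) • Q.mat := by
  induction K with
  | zero => simp
  | succ K ih =>
    rw [pow_succ', Module.End.mul_apply, ih, map_smul, pauliDiagonal_mat, smul_smul,
      ← Complex.ofReal_mul, pow_succ]

/-! ### Hilbert–Schmidt bounds for effects and prepared states. -/

namespace Measurement

lemma kernel_nonneg (t : Bits s) (x y : Bits k) : 0 ≤ m.kernel t x y :=
  Finset.sum_nonneg fun P _ => by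
    split_ifs
    · exact m.noise_mem.1 P
    · exact le_rfl

lemma kernel_le_one (t : Bits s) (x y : Bits k) : m.kernel t x y ≤ 1 := by
  rw [← m.noise_mem.2]
  refine Finset.sum_le_sum fun P _ => ?_
  split_ifs
  · exact le_rfl
  · exact m.noise_mem.1 P

lemma isHermitian_effect (t : Bits s) (x : Bits k) : (m.effect t x).IsHermitian := by
  refine Matrix.isHermitian_conjTranspose_mul_mul m.V ?_
  rw [Matrix.IsHermitian, Matrix.diagonal_conjTranspose]
  congr 1
  ext y
  simp

lemma trace_effect_sq (t : Bits s) (x : Bits k) :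
    (m.effect t x * m.effect t x).trace = ((∑ y, m.kernel t x y ^ 2 : ℝ) : ℂ) := by
  have h : conjBy m.V (m.effect t x) = Matrix.diagonal (fun y => (m.kernel t x y : ℂ)) := by
    rw [conjBy_apply, effect, Matrix.mul_assoc, Matrix.mul_assoc, V_mul_conjTranspose,
      Matrix.mul_one, ← Matrix.mul_assoc, V_mul_conjTranspose, Matrix.one_mul]
  rw [trace_effect_mul, h]
  push_cast
  exact Finset.sum_congr rfl fun y _ => by rw [Matrix.diagonal_apply_eq, pow_two]

/-- By Parseval the sum is D times the squared Hilbert–Schmidt norm of the effect, whose D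
eigenvalues lie in [0, 1]. -/
lemma sum_norm_sq_trace_effect_le (t : Bits s) (x : Bits k) :
    ∑ P : Pauli k, ‖(P.mat * m.effect t x).trace‖ ^ 2 ≤ (2 : ℝ) ^ k * 2 ^ k := by
  have h := Pauli.sum_norm_sq_trace (m.isHermitian_effect t x)
  rw [trace_effect_sq] at h
  have h' : ∑ P : Pauli k, ‖(P.mat * m.effect t x).trace‖ ^ 2 =
      (2 : ℝ) ^ k * ∑ y, m.kernel t x y ^ 2 := by exact_mod_cast h
  rw [h']
  refine mul_le_mul_of_nonneg_left ?_ (by positivity)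
  calc ∑ y, m.kernel t x y ^ 2 ≤ ∑ _y : Bits k, (1 : ℝ) :=
        Finset.sum_le_sum fun y _ => pow_le_one₀ (m.kernel_nonneg t x y) (m.kernel_le_one t x y)
    _ = 2 ^ k := by simp [ZMod.card]

end Measurement

/-- Nonnegative 2 × 2 minors give |A_ij|² ≤ A_ii A_jj; summation yields the claim. For density
matrices it says that the purity is at most 1. -/
lemma trace_mul_self_re_le {n : Type*} [Fintype n] {A : Matrix n n ℂ} (hA : A.PosSemidef) :
    (A * A).trace.re ≤ A.trace.re ^ 2 := by
  classical
  have hentry : ∀ i j, (A i j * A j i).re ≤ (A i i).re * (A j j).re := by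
    intro i j
    have hdet := (hA.submatrix ![i, j]).det_nonneg
    rw [Matrix.det_fin_two] at hdet
    simp only [Matrix.submatrix_apply, Matrix.cons_val_zero, Matrix.cons_val_one] at hdet
    have h1 : (0 : ℝ) ≤ (A i i * A j j - A i j * A j i).re := (Complex.le_def.1 hdet).1
    have him : (A i i).im = 0 := (Complex.conj_eq_iff_im.1 (hA.isHermitian.apply i i))
    rw [Complex.sub_re, Complex.mul_re (A i i), him] at h1
    linarith
  calc (A * A).trace.re = ∑ i, ∑ j, (A i j * A j i).re := by
        simp only [Matrix.trace, Matrix.diag_apply, Matrix.mul_apply, Complex.re_sum]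
    _ ≤ ∑ i, ∑ j, (A i i).re * (A j j).re :=
        Finset.sum_le_sum fun i _ => Finset.sum_le_sum fun j _ => hentry i j
    _ = A.trace.re ^ 2 := by
        simp only [Matrix.trace, Matrix.diag_apply, Complex.re_sum]
        rw [pow_two, Finset.sum_mul_sum]

lemma Preparation.sum_norm_sq_trace_le :
    ∑ P : Pauli k, ‖(P.mat * p.σ).trace‖ ^ 2 ≤ (2 : ℝ) ^ k := by
  have h := congrArg Complex.re (Pauli.sum_norm_sq_trace p.posSemidef.isHermitian)
  rw [Complex.ofReal_re] at h
  have h2 : ((2 : ℂ) ^ k * (p.σ * p.σ).trace).re = (2 : ℝ) ^ k * (p.σ * p.σ).trace.re := by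
    rw [show (2 : ℂ) ^ k = (((2 : ℝ) ^ k : ℝ) : ℂ) by push_cast; rfl, Complex.re_ofReal_mul]
  rw [h, h2]
  have h3 := trace_mul_self_re_le p.posSemidef
  rw [p.trace_eq_one] at h3
  exact mul_le_of_le_one_right (by positivity) (by simpa using h3)

/-- The Markovian model with eigenvalues `μ` and eigenvectors `r`, `l` of the transfer
matrices. -/
noncomputable def spectralModel (μ : Pauli k → ℝ) (r l : Pauli k → EuclideanSpace ℝ (Bits s)) :
    MarkovModel k s where
  prep p := pauliDiagonal fun Q => inner ℝ (l Q) (prepVector c p Q)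
  qec := pauliDiagonal μ
  meas m := ∑ t, m.Λ t ∘ₗ pauliDiagonal fun Q => √(c.marginal t) * r Q t

/-- The error of the spectral model on a Pauli operator. -/
lemma trace_sub_prediction_mat (hc : c.SyndromeMarginalIndependence)
    (hp : ∀ t, p.γ c.sStar t = c.marginal t) (μ : Pauli k → ℝ)
    (r l : Pauli k → EuclideanSpace ℝ (Bits s)) (K : ℕ) (x : Bits k) (Q : Pauli k) :
    (m.povm x * Λtot c p m K Q.mat).trace -
      (m.povm x * (spectralModel c μ r l).meas m (((spectralModel c μ r l).qec ^ K)
        ((spectralModel c μ r l).prep p Q.mat))).trace =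
    ∑ t, ((√(c.marginal t) * ((c.transfer Q ^ K) (prepVector c p Q) -
      μ Q ^ K • inner ℝ (l Q) (prepVector c p Q) • r Q) t : ℝ) : ℂ) *
        (Q.mat * m.effect t x).trace := by
  simp only [spectralModel, Λtot, LinearMap.sum_apply, LinearMap.comp_apply,
    pauliDiagonal_mat, map_smul, pauliDiagonal_pow_mat, pathSum_mat c p hc hp,
    Matrix.trace_sum, Matrix.mul_smul, Matrix.trace_smul, m.trace_povm_mul_Λ,
    Matrix.trace_mul_comm (m.effect _ x), smul_eq_mul, PiLp.sub_apply, PiLp.smul_apply,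
    Finset.smul_sum, Finset.mul_sum]
  rw [← Finset.sum_sub_distrib]
  refine Finset.sum_congr rfl fun t _ => ?_
  push_cast
  ring

/-- Cauchy–Schwarz is used over syndromes and then over Pauli operators. The factor √γ_t left over
from the transfer matrix makes the first a γ-average, so the number of syndromes does not enter; the
second gives D⁻¹ · √D · D = √D. -/
theorem norm_trace_sub_prediction_le (hc : c.SyndromeMarginalIndependence)
    (hp : ∀ t, p.γ c.sStar t = c.marginal t) (μ : Pauli k → ℝ)
    (r l : Pauli k → EuclideanSpace ℝ (Bits s)) (K : ℕ) (x : Bits k) {B : ℝ}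
    (hB : ∀ Q, ‖(c.transfer Q ^ K) (prepVector c p Q) -
      μ Q ^ K • inner ℝ (l Q) (prepVector c p Q) • r Q‖ ≤ B) :
    ‖(m.povm x * Λtot c p m K p.σ).trace - (spectralModel c μ r l).prediction p m K x‖ ≤
      B * √((2 : ℝ) ^ k) := by
  set M := spectralModel c μ r l with hM
  set N : Pauli k → EuclideanSpace ℝ (Bits s) := fun Q => (c.transfer Q ^ K) (prepVector c p Q) -
      μ Q ^ K • inner ℝ (l Q) (prepVector c p Q) • r Q with hN
  have hB0 : 0 ≤ B := (norm_nonneg _).trans (hB fun _ => Pauli1.I)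
  set S : Pauli k → ℝ := fun Q => ∑ t, c.marginal t * ‖(Q.mat * m.effect t x).trace‖ ^ 2 with hS
  have hS0 : ∀ Q, 0 ≤ S Q := fun Q =>
    Finset.sum_nonneg fun t _ => mul_nonneg (c.marginal_nonneg t) (sq_nonneg _)
  have hexp : (m.povm x * Λtot c p m K p.σ).trace - M.prediction p m K x =
      ∑ Q : Pauli k, (((2 : ℂ) ^ k)⁻¹ * (Q.mat * p.σ).trace) *
        ∑ t, ((√(c.marginal t) * N Q t : ℝ) : ℂ) * (Q.mat * m.effect t x).trace := by
    simp only [hN, ← trace_sub_prediction_mat c p m hc hp μ r l K x]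
    have hσ := Pauli.eq_sum_mat p.σ
    rw [MarkovModel.prediction]
    conv_lhs => rw [hσ]
    simp only [map_sum, map_smul, Matrix.mul_sum, Matrix.mul_smul, Matrix.trace_sum,
      Matrix.trace_smul, smul_eq_mul]
    rw [← Finset.sum_sub_distrib]
    exact Finset.sum_congr rfl fun Q _ => by rw [← hM]; ring
  have hterm : ∀ Q, ‖∑ t, ((√(c.marginal t) * N Q t : ℝ) : ℂ) *
      (Q.mat * m.effect t x).trace‖ ≤ B * √(S Q) := by
    intro Q
    calc _ ≤ ∑ t, ‖N Q t‖ * (√(c.marginal t) * ‖(Q.mat * m.effect t x).trace‖) := by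
          refine (norm_sum_le _ _).trans (Finset.sum_le_sum fun t _ => le_of_eq ?_)
          rw [norm_mul, Complex.norm_real, norm_mul, Real.norm_of_nonneg (Real.sqrt_nonneg _)]
          ring
      _ ≤ √(∑ t, ‖N Q t‖ ^ 2) *
          √(∑ t, (√(c.marginal t) * ‖(Q.mat * m.effect t x).trace‖) ^ 2) :=
          Real.sum_mul_le_sqrt_mul_sqrt _ _ _
      _ = ‖N Q‖ * √(S Q) := by
          rw [EuclideanSpace.norm_eq]
          simp only [mul_pow, Real.sq_sqrt (c.marginal_nonneg _), hS]
      _ ≤ B * √(S Q) := mul_le_mul_of_nonneg_right (hB Q) (Real.sqrt_nonneg _)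
  have hSsum : ∑ Q, S Q ≤ (2 : ℝ) ^ k * 2 ^ k := by
    rw [hS, Finset.sum_comm]
    calc ∑ t, ∑ Q : Pauli k, c.marginal t * ‖(Q.mat * m.effect t x).trace‖ ^ 2
        ≤ ∑ t, c.marginal t * ((2 : ℝ) ^ k * 2 ^ k) := by
          refine Finset.sum_le_sum fun t _ => ?_
          rw [← Finset.mul_sum]
          exact mul_le_mul_of_nonneg_left (m.sum_norm_sq_trace_effect_le t x)
            (c.marginal_nonneg t)
      _ = (2 : ℝ) ^ k * 2 ^ k := by rw [← Finset.sum_mul, c.sum_marginal, one_mul]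
  have hCS : ∑ Q : Pauli k, ‖(Q.mat * p.σ).trace‖ * √(S Q) ≤ √((2 : ℝ) ^ k) * 2 ^ k := by
    calc _ ≤ √(∑ Q : Pauli k, ‖(Q.mat * p.σ).trace‖ ^ 2) * √(∑ Q, √(S Q) ^ 2) :=
          Real.sum_mul_le_sqrt_mul_sqrt _ _ _
      _ ≤ √((2 : ℝ) ^ k) * √((2 : ℝ) ^ k * 2 ^ k) := by
          simp only [Real.sq_sqrt (hS0 _)]
          exact mul_le_mul (Real.sqrt_le_sqrt p.sum_norm_sq_trace_le)
            (Real.sqrt_le_sqrt hSsum) (Real.sqrt_nonneg _) (Real.sqrt_nonneg _)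
      _ = _ := by rw [Real.sqrt_mul_self (by positivity)]
  rw [hexp]
  calc _ ≤ ∑ Q : Pauli k, ((2 : ℝ) ^ k)⁻¹ * B * (‖(Q.mat * p.σ).trace‖ * √(S Q)) := by
        refine (norm_sum_le _ _).trans (Finset.sum_le_sum fun Q _ => ?_)
        rw [norm_mul, norm_mul, norm_inv, norm_pow, Complex.norm_ofNat]
        calc _ ≤ ((2 : ℝ) ^ k)⁻¹ * ‖(Q.mat * p.σ).trace‖ * (B * √(S Q)) :=
              mul_le_mul_of_nonneg_left (hterm Q) (by positivity)
          _ = _ := by ring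
    _ = ((2 : ℝ) ^ k)⁻¹ * B * ∑ Q : Pauli k, ‖(Q.mat * p.σ).trace‖ * √(S Q) := by
        rw [Finset.mul_sum]
    _ ≤ ((2 : ℝ) ^ k)⁻¹ * B * (√((2 : ℝ) ^ k) * 2 ^ k) :=
        mul_le_mul_of_nonneg_left hCS (by positivity)
    _ = B * √((2 : ℝ) ^ k) := by field_simp

end Model

end QEC

/-! ### Assembly of the model and its constants. -/

theorem mainTheorem1 {k s : ℕ} (c : QEC.Cycle k s)
    (hc : c.SyndromeMarginalIndependence)
    (ε₁ : ℝ) (hε₁ : 0 < ε₁) (hε₁' : ε₁ ≤ 1 / 64) (hf : 1 - ε₁ ≤ c.f₁)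
    (Exp : Set (QEC.Preparation k s × QEC.Measurement k s))
    (hprep : ∀ e ∈ Exp, ∀ t : QEC.Bits s, e.1.γ c.sStar t = c.marginal t)
    (ε G' G : ℝ) (hε : ε = 2 * (1 + √2) * √ε₁)
    (hG' : G' = 1 + 1 / (1 - ε / (1 - 2 * √ε₁)))
    (hG : G = G' * √((2 : ℝ) ^ k)) :
    G' < 7 ∧
      ∃ M : QEC.MarkovModel k s, M.IsApprox c Exp G ε ∧
        ∀ e ∈ Exp, ∀ K : ℕ, 0 < K → ∀ x : QEC.Bits k,
          ‖(QEC.experimentProb c e.1 e.2 K x : ℂ) - M.prediction e.1 e.2 K x‖ ≤ G * ε ^ K := by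
  have hs : √ε₁ ≤ 1 / 8 := Real.sqrt_le_iff.2 ⟨by norm_num, by norm_num; linarith⟩
  have hs0 : 0 < √ε₁ := Real.sqrt_pos.2 hε₁
  have h2 : √2 < 1.42 := (Real.sqrt_lt' (by norm_num)).2 (by norm_num)
  have h20 : 0 ≤ √2 := Real.sqrt_nonneg 2
  have hεpos : 0 < ε := by rw [hε]; positivity
  have hε1 : ε < 1 := by rw [hε]; nlinarith
  have hq0 : 0 < ε / (1 - 2 * √ε₁) := div_pos hεpos (by linarith)
  -- At the extreme √ε₁ = 1/8 the quotient is about 0.805; the bound 5/6 is what G' < 1 + 6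
  -- requires.
  have hq : ε / (1 - 2 * √ε₁) < 5 / 6 := by
    rw [div_lt_iff₀ (by linarith), hε]; nlinarith
  -- The perturbation estimate already holds with prefactor 2, so this lower bound is all that is
  -- needed of G' for the approximation.
  have hG'2 : 2 ≤ G' := by
    have : 1 ≤ 1 / (1 - ε / (1 - 2 * √ε₁)) := by
      rw [le_div_iff₀ (by linarith)]; linarith
    linarith
  have hG'7 : G' < 7 := by
    have : 1 / (1 - ε / (1 - 2 * √ε₁)) < 6 := by
      rw [div_lt_iff₀ (by linarith)]; linarith
    linarith
  have hD : 0 < √((2 : ℝ) ^ k) := Real.sqrt_pos.2 (by positivity)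
  -- Here δ = 2√ε₁, so the smallness condition δ ≤ 1/4 is exactly ε₁ ≤ 1/64. The spectral data
  -- depend on the cycle and `Q` only, hence one model serves all settings and all K.
  have hexists := fun Q => QEC.exists_rankOne_approx_pow (c.idealVector Q)
    (c.norm_idealVector Q) (c.transfer Q) (by positivity) (by linarith)
    (c.norm_transfer_sub_le hc hf Q)
  choose μ r l hμ using hexists
  have hbound : ∀ e ∈ Exp, ∀ K : ℕ, 0 < K → ∀ x : QEC.Bits k,
      ‖(e.2.povm x * QEC.Λtot c e.1 e.2 K e.1.σ).trace -
        (QEC.spectralModel c μ r l).prediction e.1 e.2 K x‖ ≤ G * ε ^ K := by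
    intro e he K hK x
    have hB : ∀ Q, ‖(c.transfer Q ^ K) (QEC.prepVector c e.1 Q) -
        μ Q ^ K • inner ℝ (l Q) (QEC.prepVector c e.1 Q) • r Q‖ ≤ G' * ε ^ K := by
      intro Q
      have hδ : (1 + √2) * (2 * √ε₁) = ε := by rw [hε]; ring
      have h := hμ Q K hK (QEC.prepVector c e.1 Q)
      rw [hδ] at h
      have hεK : 0 ≤ ε ^ K := by positivity
      calc _ ≤ 2 * ε ^ K * ‖QEC.prepVector c e.1 Q‖ := h
        _ ≤ 2 * ε ^ K :=
            mul_le_of_le_one_right (by positivity) (QEC.norm_prepVector_le c e.1 Q)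
        _ ≤ G' * ε ^ K := mul_le_mul_of_nonneg_right hG'2 hεK
    have h := QEC.norm_trace_sub_prediction_le c e.1 e.2 hc (hprep e he) μ r l K x hB
    rw [hG]
    linarith
  refine ⟨hG'7, QEC.spectralModel c μ r l,
    ⟨by rw [hG]; exact mul_pos (by linarith) hD, hεpos, hε1, hbound⟩, ?_⟩
  intro e he K hK x
  rw [QEC.experimentProb_eq]
  exact hbound e he K hK x
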